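/- For a prime $p$ let $\mathbb{F}_p=\mathbb{Z}/p\mathbb{Z}$, and let $\Gamma\subseteq\mathbb{F}_p^*$ denote a multiplicative subgroup. Write $$\widehat{\Gamma}(\xi)=\sum_{x\in\Gamma}e^{-2\pi i x\xi/p},\qquad M(\Gamma)=\max_{\xi\in\mathbb{F}_p,\ \xi\ne 0}\Big|\sum_{x\in\Gamma}e^{2\pi i x\xi/p}\Big|,$$ $$E(\Gamma)=\big|\{(a_1,a_2,b_1,b_2)\in\Gamma^4:\ a_1+b_1=a_2+b_2\}\big|,$$ and let $\log$ be the logarithm to base $2$. (1) There is an absolute constant $C>0$ such that for every prime $p$ and every multiplicative subgroup $\Gamma\subseteq\mathbb{F}_p^*$ with $2\le|\Gamma|\le p^{2/3}$, $$M(\Gamma)\le C\,|\Gamma|^{1/2}\,p^{1/6}\,\log^{1/6}|\Gamma|.$$ (2) For every constant $A>0$ there is a constant $C=C(A)>0$ such that for every prime $p$ and every multiplicative subgroup $\Gamma\subseteq\mathbb{F}_p^*$ with $|\Gamma|\le p^{2/3}$ and $$p^{10}\le A\,|\Gamma|^{22}\,E(\Gamma)^2\,\log^{9}|\Gamma|,$$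 one has $$\sum_{\xi\in\mathbb{F}_p,\ \xi\ne 0}\big|\widehat{\Gamma}(\xi)\big|^{32/5}\le C\,|\Gamma|^{16/5}\,E(\Gamma)^{2/5}\,p^{6/5}\,\log^{9/5}|\Gamma|.$$ -/

import Mathlib

noncomputable section

namespace SubgroupSums

open Classical in
/-- A multiplicative subgroup of `𝔽_p^*`, viewed as a finite subset of `𝔽_p = ZMod p`. -/
def toFinset {p : ℕ} [Fact p.Prime] (Γ : Subgroup (ZMod p)ˣ) : Finset (ZMod p) :=
  Finset.univ.filter fun x => ∃ γ ∈ Γ, (γ : ZMod p) = x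

/-- The largest nontrivial Fourier coefficient
`M(A) = max_{ξ ≠ 0} |∑_{x ∈ A} e^{2πi x ξ / p}|` (a supremum over a finite nonempty index set);
`ZMod.stdAddChar` is the character `j ↦ e^{2πi j / p}` of `ZMod p`. -/
def maxCoeff {p : ℕ} [Fact p.Prime] (A : Finset (ZMod p)) : ℝ :=
  ⨆ ξ : {ξ : ZMod p // ξ ≠ 0}, ‖∑ x ∈ A, ZMod.stdAddChar (x * ξ.1)‖

/-- The Fourier transform `Â(ξ) = ∑_x A(x) e^{-2πi x ξ / p}` of the characteristic function
of `A`. -/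
def hat {p : ℕ} [Fact p.Prime] (A : Finset (ZMod p)) (ξ : ZMod p) : ℂ :=
  ZMod.dft (fun x : ZMod p => if x ∈ A then (1 : ℂ) else 0) ξ

/-- The additive energy `E(A)`: the number of quadruples in `A` with `a₁ + b₁ = a₂ + b₂`. -/
def energy {p : ℕ} [Fact p.Prime] (A : Finset (ZMod p)) : ℕ :=
  Finset.addEnergy A A

end SubgroupSums

end

/-! Write t = |Γ|, L = log t, and let E₃(A) be the sum over z of the cubed number of representations
of z as a difference in A (`thirdEnergy`).

Spectral step (`meanSquare_pow_six_le`). For a union R of cosets of Γ let M be the matrix e(ax) with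
a ∈ R, x ∈ Γ. By invariance the all-ones vector is an eigenvector of M*M, with eigenvalue λ = t⁻¹
Σ_{b ∈ R} |Γ̂(b)|². Hence λ³ ≤ tr (M*M)³. This trace is a sixfold exponential sum, which
Cauchy–Schwarz and Parseval bound by p (E₃(Γ) E₃(R))^{1/2}.

Arithmetic step. Stepanov's method (`card_pow_three_le_of_pow_values`) bounds the number of x for
which (x^t, (1-x)^t) lies in a small set. Applied to level sets of shift counts, it gives E₃(R) ≪ n⁵
t³ L when R consists of n cosets (`thirdEnergy_le`).

A single coset yields |Γ̂(ξ)|⁶ ≪ p t³ L, which is (1). If |Γ̂| ≥ τ on K cosets, then K τ¹² ≪ p² t⁶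
L². For (2) the sum is split at the τ belonging to K ≈ p E³ / t¹⁰. Below τ the fourth moment pE is
used; above τ there are fewer than K cosets, and the sixth-power bound applies pointwise. The
hypothesis on p together with E² ≪ t⁵ L makes this K admissible and makes the upper part fit. -/

noncomputable section

namespace SubgroupSums

open Polynomial

/-! ### Stepanov's method for pairs of power values. -/

section Stepanov

variable {p : ℕ} [Fact p.Prime]

/-- The derivation `X(1-X) d/dX` on polynomials. -/
def theta (p : ℕ) [Fact p.Prime] : Module.End (ZMod p) (ZMod p)[X] :=
  LinearMap.mulLeft (ZMod p) (X * (1 - X)) ∘ₗ derivative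

lemma theta_apply (f : (ZMod p)[X]) : theta p f = X * (1 - X) * derivative f := rfl

/-- Away from 0 and 1 the factor X(1-X) is nonzero, so each application of `theta` lowers the order
of vanishing by exactly one; the factors m, m-1, ..., 1 that appear are units because m < p. -/
lemma eval_theta_pow_ne_zero {x : ZMod p} (h0 : x ≠ 0) (h1 : x ≠ 1) (m : ℕ) (hm : m < p)
    (g : (ZMod p)[X]) (hg : g.eval x ≠ 0) :
    ((theta p ^ m) ((X - C x) ^ m * g)).eval x ≠ 0 := by
  induction m generalizing g with
  | zero => simpa using hg
  | succ m ih =>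
    have key : theta p ((X - C x) ^ (m + 1) * g) =
        (X - C x) ^ m * (X * (1 - X) * (C ((m : ZMod p) + 1) * g + (X - C x) * derivative g)) := by
      rw [theta_apply]
      simp only [derivative_mul, derivative_X_sub_C_pow, Nat.add_sub_cancel, map_add, map_natCast,
        map_one]
      push_cast
      ring
    rw [pow_succ, Module.End.mul_apply, key]
    refine ih (by omega) _ ?_
    have h2 : ((m : ZMod p) + 1) ≠ 0 := by
      have : ((m + 1 : ℕ) : ZMod p) ≠ 0 := by
        rw [Ne, ZMod.natCast_eq_zero_iff]
        exact fun h => absurd (Nat.le_of_dvd (by omega) h) (by omega)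
      simpa using this
    simp only [eval_mul, eval_X, eval_sub, eval_one, eval_add, eval_C, sub_self, zero_mul, add_zero]
    exact mul_ne_zero (mul_ne_zero h0 (sub_ne_zero.2 h1.symm)) (mul_ne_zero h2 hg)

lemma le_rootMultiplicity_of_theta {x : ZMod p} (h0 : x ≠ 0) (h1 : x ≠ 1) {D : ℕ} (hD : D ≤ p)
    {f : (ZMod p)[X]} (hf : f ≠ 0) (h : ∀ k < D, ((theta p ^ k) f).eval x = 0) :
    D ≤ f.rootMultiplicity x := by
  by_contra! hlt
  obtain ⟨g, hfg, hg⟩ := f.exists_eq_pow_rootMultiplicity_mul_and_not_dvd hf x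
  refine eval_theta_pow_ne_zero h0 h1 (f.rootMultiplicity x) (by omega) g ?_ ?_
  · rwa [dvd_iff_isRoot] at hg
  · rw [← hfg]; exact h _ hlt

/-- A nonzero polynomial of degree less than `p` with at most `r` terms does not vanish at `1`
to order `r`. -/
lemma eq_zero_of_card_support_le (r : ℕ) (f : (ZMod p)[X]) (hdeg : ∀ j ∈ f.support, j < p)
    (hs : f.support.card ≤ r) (hd : (X - C 1) ^ r ∣ f) : f = 0 := by
  induction r generalizing f with
  | zero => simpa using hs
  | succ r ih =>
    by_contra hf
    obtain ⟨k, hk⟩ := Finset.nonempty_iff_ne_empty.2 (mt support_eq_empty.1 hf)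
    -- Passing to X f' - k f removes the monomial X^k, keeps every other one since exponents below p
    -- are distinct mod p, and costs only one order of vanishing at 1.
    set g := X * derivative f - C (k : ZMod p) * f with hg
    have hc : ∀ j, g.coeff j = ((j : ZMod p) - k) * f.coeff j := by
      intro j
      rw [hg, coeff_sub, coeff_C_mul]
      cases j with
      | zero => simp
      | succ j => rw [coeff_X_mul, coeff_derivative]; push_cast; ring
    have hsub : g.support ⊆ f.support.erase k := by
      intro j hj
      rw [mem_support_iff, hc] at hj
      rw [Finset.mem_erase, mem_support_iff]
      refine ⟨fun h => hj (by rw [h]; simp), right_ne_zero_of_mul hj⟩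
    have hg0 : g = 0 := by
      refine ih g (fun j hj => hdeg j (Finset.mem_of_mem_erase (hsub hj))) ?_ ?_
      · have := Finset.card_le_card hsub
        rw [Finset.card_erase_of_mem hk] at this
        omega
      · obtain ⟨q, hq⟩ := hd
        refine ⟨X * (C ((r : ZMod p) + 1) * q + (X - C 1) * derivative q)
          - C (k : ZMod p) * ((X - C 1) * q), ?_⟩
        rw [hg, hq, derivative_mul, derivative_X_sub_C_pow, Nat.add_sub_cancel]
        simp only [map_add, map_natCast, map_one]
        push_cast
        ring
    have hmono : ∀ j, j ≠ k → f.coeff j = 0 := by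
      intro j hjk
      by_contra hj
      have h1 := hc j
      rw [hg0, coeff_zero] at h1
      rcases mul_eq_zero.1 h1.symm with h2 | h2
      · have h3 : ((j : ℕ) : ZMod p) = (k : ℕ) := sub_eq_zero.1 h2
        rw [ZMod.natCast_eq_natCast_iff', Nat.mod_eq_of_lt (hdeg j (mem_support_iff.2 hj)),
          Nat.mod_eq_of_lt (hdeg k hk)] at h3
        exact hjk h3
      · exact hj h2
    have hfm : f = monomial k (f.coeff k) := by
      ext j
      rw [coeff_monomial]
      split_ifs with h
      · rw [h]
      · exact hmono j (Ne.symm h)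
    have he : f.eval 1 = 0 := by
      obtain ⟨q, hq⟩ := hd
      rw [hq]; simp
    rw [hfm, eval_monomial, one_pow, mul_one] at he
    exact mem_support_iff.1 hk he

/-- The term f 0 is divisible by Y, since all later terms are; so it vanishes, Y cancels, and the
argument repeats. -/
lemma eq_zero_of_sum_pow_mul {R : Type*} [CommRing R] [IsDomain R] {Y : R} (hY : Y ≠ 0) (B : ℕ)
    (f : ℕ → R) (hf : ∀ i < B, Y ∣ f i → f i = 0) (h : ∑ i ∈ Finset.range B, Y ^ i * f i = 0) :
    ∀ i < B, f i = 0 := by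
  induction B generalizing f with
  | zero => intro i hi; omega
  | succ B ih =>
    rw [Finset.sum_range_succ'] at h
    have h' : Y * ∑ i ∈ Finset.range B, Y ^ i * f (i + 1) = - f 0 := by
      rw [Finset.mul_sum, ← sub_eq_zero, ← h]
      simp only [pow_succ, pow_zero, one_mul, sub_neg_eq_add]
      congr 1
      exact Finset.sum_congr rfl fun i _ => by ring
    have h0 : f 0 = 0 := hf 0 (by omega) ((dvd_neg).1 ⟨_, h'.symm⟩)
    rw [h0, neg_zero] at h'
    have h1 := ih (fun i => f (i + 1)) (fun i hi => hf (i + 1) (by omega))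
      ((mul_eq_zero.1 h').resolve_left hY)
    intro i hi
    cases i with
    | zero => exact h0
    | succ i => exact h1 i (by omega)

/-- Nonvanishing of the auxiliary polynomial. Grouped by powers of (1-X)^t, its coefficients f γ
have at most AB ≤ t terms and degree below p, so divisibility by (1-X)^t would force them to be
zero. Peeling off powers of X^t, with deg q < A ≤ t, then isolates each q. -/
lemma auxiliary_ne_zero {A B t : ℕ} (hA : A ≤ t) (hAB : A * B ≤ t) (hBt : B * t ≤ p)
    (q : ℕ → ℕ → (ZMod p)[X]) (hq : ∀ β γ, ∀ j ∈ (q β γ).support, j < A)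
    (h : ∑ γ ∈ Finset.range B, ∑ β ∈ Finset.range B,
      X ^ (t * β) * (1 - X) ^ (t * γ) * q β γ = 0) :
    ∀ β < B, ∀ γ < B, q β γ = 0 := by
  set f : ℕ → (ZMod p)[X] := fun γ => ∑ β ∈ Finset.range B, (X ^ t) ^ β * q β γ with hf
  have h1X : (1 - X : (ZMod p)[X]) ≠ 0 := by
    rw [← neg_ne_zero, neg_sub, ← C_1]; exact X_sub_C_ne_zero 1
  have hs : ∀ γ, (f γ).support ⊆
      (Finset.range B ×ˢ Finset.range A).image (fun x => t * x.1 + x.2) := by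
    intro γ j hj
    rw [mem_support_iff, hf, finsetSum_coeff] at hj
    obtain ⟨β, hβ, hne⟩ := Finset.exists_ne_zero_of_sum_ne_zero hj
    rw [← pow_mul, coeff_X_pow_mul'] at hne
    split_ifs at hne with hle
    · refine Finset.mem_image.2 ⟨(β, j - t * β), ?_, by simp; omega⟩
      exact Finset.mem_product.2 ⟨hβ, Finset.mem_range.2 (hq _ _ _ (mem_support_iff.2 hne))⟩
    · exact absurd rfl hne
  have hf0 : ∀ γ < B, f γ = 0 := by
    refine eq_zero_of_sum_pow_mul (Y := (1 - X) ^ t) (pow_ne_zero _ h1X) B f ?_ ?_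
    · intro γ _ hdvd
      refine eq_zero_of_card_support_le t (f γ) ?_ ?_ ?_
      · intro j hj
        obtain ⟨⟨β, α⟩, hx, rfl⟩ := Finset.mem_image.1 (hs γ hj)
        simp only [Finset.mem_product, Finset.mem_range] at hx
        have : t * (β + 1) ≤ t * B := Nat.mul_le_mul_left _ hx.1
        simp only
        nlinarith
      · refine (Finset.card_le_card (hs γ)).trans (Finset.card_image_le.trans ?_)
        simp only [Finset.card_product, Finset.card_range]
        linarith [mul_comm A B]
      · have : (X - C 1 : (ZMod p)[X]) ∣ 1 - X := ⟨-1, by simp⟩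
        exact (pow_dvd_pow_of_dvd this t).trans hdvd
    · rw [← h]
      refine Finset.sum_congr rfl fun γ _ => ?_
      rw [hf, Finset.mul_sum]
      refine Finset.sum_congr rfl fun β _ => ?_
      rw [← pow_mul, ← pow_mul]; ring
  intro β hβ γ hγ
  refine eq_zero_of_sum_pow_mul (Y := (X : (ZMod p)[X]) ^ t) (pow_ne_zero _ X_ne_zero) B
    (fun β => q β γ) ?_ (hf0 γ hγ) β hβ
  intro β _ hdvd
  ext j
  rw [X_pow_dvd_iff] at hdvd
  rw [coeff_zero]
  by_contra hj
  exact hj (hdvd j ((hq _ _ _ (mem_support_iff.2 hj)).trans_le hA))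

/-- The operator through which `theta` acts on the cofactor of `X ^ (t * β) * (1 - X) ^ (t * γ)`. -/
def thetaTwist (p : ℕ) [Fact p.Prime] (t β γ : ℕ) : Module.End (ZMod p) (ZMod p)[X] :=
  theta p + LinearMap.mulLeft (ZMod p)
    (((t * β : ℕ) : (ZMod p)[X]) * (1 - X) - ((t * γ : ℕ) : (ZMod p)[X]) * X)

/-- The logarithmic derivative of X^a (1-X)^b has only simple poles at 0 and 1, and the factor
X(1-X) in `theta` clears them. -/
lemma theta_mul_twist (t β γ : ℕ) (q : (ZMod p)[X]) :
    theta p (X ^ (t * β) * (1 - X) ^ (t * γ) * q) =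
      X ^ (t * β) * (1 - X) ^ (t * γ) * thetaTwist p t β γ q := by
  have h1 : ∀ n : ℕ, X * derivative ((X : (ZMod p)[X]) ^ n) = (n : (ZMod p)[X]) * X ^ n := by
    intro n
    cases n with
    | zero => simp
    | succ n => rw [derivative_X_pow]; simp; ring
  have h2 : ∀ n : ℕ, (1 - X) * derivative ((1 - X : (ZMod p)[X]) ^ n) =
      - ((n : (ZMod p)[X]) * (1 - X) ^ n) := by
    intro n
    cases n with
    | zero => simp
    | succ n => rw [derivative_pow]; simp; ring
  simp only [thetaTwist, LinearMap.add_apply, theta_apply, LinearMap.mulLeft_apply, derivative_mul]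
  linear_combination (1 - X) * (1 - X) ^ (t * γ) * q * h1 (t * β) +
    X * X ^ (t * β) * q * h2 (t * γ)

lemma theta_pow_mul_twist (t β γ k : ℕ) (q : (ZMod p)[X]) :
    (theta p ^ k) (X ^ (t * β) * (1 - X) ^ (t * γ) * q) =
      X ^ (t * β) * (1 - X) ^ (t * γ) * (thetaTwist p t β γ ^ k) q := by
  induction k generalizing q with
  | zero => simp
  | succ k ih =>
    rw [pow_succ, Module.End.mul_apply, theta_mul_twist, ih, pow_succ, Module.End.mul_apply]

lemma natDegree_thetaTwist_le (t β γ : ℕ) (q : (ZMod p)[X]) :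
    (thetaTwist p t β γ q).natDegree ≤ q.natDegree + 1 := by
  have h1 : (thetaTwist p t β γ q).natDegree ≤
      max (theta p q).natDegree ((((t * β : ℕ) : (ZMod p)[X]) * (1 - X) -
        ((t * γ : ℕ) : (ZMod p)[X]) * X) * q).natDegree := natDegree_add_le _ _
  refine h1.trans (max_le ?_ ?_)
  · rw [theta_apply]
    by_cases h : derivative q = 0
    · simp [h]
    · have hq : q.natDegree ≠ 0 := by
        intro h0
        rw [natDegree_eq_zero] at h0
        obtain ⟨c, rfl⟩ := h0
        simp at h
      have h2 : (derivative q).natDegree < q.natDegree := natDegree_derivative_lt hq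
      have h3 : (X * (1 - X) : (ZMod p)[X]).natDegree ≤ 2 := by compute_degree
      refine natDegree_mul_le.trans ?_
      omega
  · refine natDegree_mul_le.trans ?_
    have : (((t * β : ℕ) : (ZMod p)[X]) * (1 - X) -
        ((t * γ : ℕ) : (ZMod p)[X]) * X).natDegree ≤ 1 := by compute_degree
    omega

lemma natDegree_thetaTwist_pow_le (t β γ k : ℕ) (q : (ZMod p)[X]) :
    ((thetaTwist p t β γ ^ k) q).natDegree ≤ q.natDegree + k := by
  induction k with
  | zero => simp
  | succ k ih =>
    rw [pow_succ', Module.End.mul_apply]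
    have := natDegree_thetaTwist_le t β γ ((thetaTwist p t β γ ^ k) q)
    omega

/-- At a point x with (x^t, (1-x)^t) = y the monomial X^(tβ) (1-X)^(tγ) takes the value y.1^β y.2^γ.
One polynomial identity per y and k therefore makes the k-th `theta`-derivative vanish at all points
over y. Each polynomial has degree below 2A, so there are |H|·A·2A linear equations in A·B² unknown
coefficients. -/
lemma exists_auxiliary {A B t : ℕ} (H : Finset (ZMod p × ZMod p))
    (hcount : H.card * (A * (2 * A)) < A * B ^ 2) :
    ∃ q : ℕ → ℕ → (ZMod p)[X], (∀ β γ, ∀ j ∈ (q β γ).support, j < A) ∧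
      (∃ β < B, ∃ γ < B, q β γ ≠ 0) ∧
      ∀ y ∈ H, ∀ k < A, ∑ γ ∈ Finset.range B, ∑ β ∈ Finset.range B,
        C (y.1 ^ β * y.2 ^ γ) * (thetaTwist p t β γ ^ k) (q β γ) = 0 := by
  let V := Fin B × Fin B × Fin A → ZMod p
  let Q : ℕ → ℕ → V →ₗ[ZMod p] (ZMod p)[X] := fun β γ =>
    if h : β < B ∧ γ < B then
      ∑ α : Fin A, monomial (α : ℕ) ∘ₗ LinearMap.proj ((⟨β, h.1⟩, ⟨γ, h.2⟩, α) : Fin B × Fin B × Fin A)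
    else 0
  have hQs : ∀ v β γ, ∀ j ∈ (Q β γ v).support, j < A := by
    intro v β γ j hj
    by_contra! hle
    rw [mem_support_iff] at hj
    apply hj
    simp only [Q]
    split_ifs with h
    · simp only [LinearMap.sum_apply, LinearMap.comp_apply, finsetSum_coeff, coeff_monomial]
      refine Finset.sum_eq_zero fun α _ => if_neg ?_
      have := α.2
      omega
    · simp
  have hQd : ∀ v β γ, A ≠ 0 → (Q β γ v).natDegree < A := by
    intro v β γ hA
    by_cases h : Q β γ v = 0
    · rw [h, natDegree_zero]; omega
    · exact hQs v β γ _ (natDegree_mem_support_of_nonzero h)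
  let W : H × Fin A → V →ₗ[ZMod p] (ZMod p)[X] := fun y =>
    ∑ γ ∈ Finset.range B, ∑ β ∈ Finset.range B,
      LinearMap.mulLeft (ZMod p) (C (y.1.1.1 ^ β * y.1.1.2 ^ γ)) ∘ₗ
        (thetaTwist p t β γ ^ (y.2 : ℕ)) ∘ₗ Q β γ
  have hW : ∀ y v, W y v = ∑ γ ∈ Finset.range B, ∑ β ∈ Finset.range B,
      C (y.1.1.1 ^ β * y.1.1.2 ^ γ) * (thetaTwist p t β γ ^ (y.2 : ℕ)) (Q β γ v) := by
    intro y v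
    simp [W, LinearMap.sum_apply, mul_assoc]
  let M : V →ₗ[ZMod p] (H × Fin A × Fin (2 * A) → ZMod p) :=
    LinearMap.pi fun y => lcoeff (ZMod p) (y.2.2 : ℕ) ∘ₗ W (y.1, y.2.1)
  have hker : LinearMap.ker M ≠ ⊥ := by
    apply LinearMap.ker_ne_bot_of_finrank_lt
    simp only [V, Module.finrank_fintype_fun_eq_card, Fintype.card_prod, Fintype.card_fin,
      Fintype.card_coe]
    calc _ < A * B ^ 2 := hcount
      _ = _ := by ring
  obtain ⟨v, hv, hv0⟩ := (Submodule.ne_bot_iff _).1 hker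
  refine ⟨fun β γ => Q β γ v, hQs v, ?_, ?_⟩
  · obtain ⟨⟨β, γ, α⟩, hne⟩ := Function.ne_iff.1 hv0
    refine ⟨β, β.2, γ, γ.2, fun h => hne ?_⟩
    have := congrArg (fun f => f.coeff (α : ℕ)) h
    simp only [Q, β.2, γ.2, and_self, dif_pos, LinearMap.sum_apply, LinearMap.comp_apply,
      finsetSum_coeff, coeff_monomial, Fin.eta, coeff_zero, Fin.val_inj,
      Finset.sum_ite_eq', Finset.mem_univ, if_true] at this
    exact this
  · intro y hy k hk
    have h1 := hW (⟨y, hy⟩, ⟨k, hk⟩) v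
    simp only at h1
    rw [← h1]
    ext j
    rw [coeff_zero]
    by_cases hj : j < 2 * A
    · have := congrFun (LinearMap.mem_ker.1 hv) (⟨y, hy⟩, ⟨k, hk⟩, ⟨j, hj⟩)
      simpa [M] using this
    · apply coeff_eq_zero_of_natDegree_lt
      refine lt_of_le_of_lt (b := 2 * A - 1) ?_ (by omega)
      rw [h1]
      refine natDegree_sum_le_of_forall_le _ _ fun γ _ =>
        natDegree_sum_le_of_forall_le _ _ fun β _ => ?_
      refine (natDegree_C_mul_le _ _).trans ((natDegree_thetaTwist_pow_le _ _ _ _ _).trans ?_)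
      have := hQd v β γ (by omega)
      omega

/-- The auxiliary polynomial vanishes to order A at each point of S, while its degree is at most
2(B-1)t + A ≤ 2Bt. -/
lemma card_mul_le_of_parameters {A B t : ℕ} (hA : A ≤ t) (hAB : A * B ≤ t) (hBt : B * t ≤ p)
    (hB : B ≠ 0) (S : Finset (ZMod p)) (h0 : ∀ x ∈ S, x ≠ 0 ∧ x ≠ 1)
    (H : Finset (ZMod p × ZMod p)) (hH : ∀ x ∈ S, (x ^ t, (1 - x) ^ t) ∈ H)
    (hcount : H.card * (2 * A) < B ^ 2) : S.card * A ≤ 2 * (B * t) := by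
  rcases Nat.eq_zero_or_pos A with rfl | hA0
  · simp
  obtain ⟨q, hqA, ⟨β₀, hβ₀, γ₀, hγ₀, hne⟩, hq⟩ := exists_auxiliary (A := A) (B := B) (t := t) H
    (by calc _ = A * (H.card * (2 * A)) := by ring
          _ < _ := Nat.mul_lt_mul_of_pos_left hcount hA0)
  set Ψ : (ZMod p)[X] := ∑ γ ∈ Finset.range B, ∑ β ∈ Finset.range B,
      X ^ (t * β) * (1 - X) ^ (t * γ) * q β γ with hΨ
  have hΨ0 : Ψ ≠ 0 := fun h => hne (auxiliary_ne_zero hA hAB hBt q hqA h β₀ hβ₀ γ₀ hγ₀)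
  have hAp : A ≤ p := hA.trans ((Nat.le_mul_of_pos_left t (Nat.pos_of_ne_zero hB)).trans hBt)
  have hroot : ∀ x ∈ S, A ≤ Ψ.rootMultiplicity x := by
    intro x hx
    refine le_rootMultiplicity_of_theta (h0 x hx).1 (h0 x hx).2 hAp hΨ0 fun k hk => ?_
    have := congrArg (eval x) (hq _ (hH x hx) k hk)
    rw [eval_zero] at this
    rw [hΨ, map_sum, eval_finsetSum, ← this, eval_finsetSum]
    refine Finset.sum_congr rfl fun γ _ => ?_
    rw [map_sum, eval_finsetSum, eval_finsetSum]
    refine Finset.sum_congr rfl fun β _ => ?_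
    rw [theta_pow_mul_twist]
    simp only [eval_mul, eval_pow, eval_X, eval_sub, eval_one, eval_C, pow_mul]
  have hdeg : Ψ.natDegree ≤ 2 * (B * t) := by
    refine natDegree_sum_le_of_forall_le _ _ fun γ hγ =>
        natDegree_sum_le_of_forall_le _ _ fun β hβ => ?_
    rw [Finset.mem_range] at hγ hβ
    have h1 : (1 - X : (ZMod p)[X]).natDegree ≤ 1 := by compute_degree
    have h2 : (q β γ).natDegree ≤ A := by
      by_cases h : q β γ = 0
      · simp [h]
      · exact (hqA β γ _ (natDegree_mem_support_of_nonzero h)).le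
    have h3 : ((1 - X : (ZMod p)[X]) ^ (t * γ)).natDegree ≤ t * γ := by
      exact natDegree_pow_le.trans ((Nat.mul_le_mul_left _ h1).trans_eq (mul_one _))
    have h4 : (X ^ (t * β) * (1 - X) ^ (t * γ) * q β γ).natDegree ≤ t * β + t * γ + A := by
      refine natDegree_mul_le.trans (add_le_add (natDegree_mul_le.trans
        (add_le_add (natDegree_X_pow_le _) h3)) h2)
    have h5 : t * (β + 1) ≤ t * B := Nat.mul_le_mul_left _ hβ
    have h6 : t * (γ + 1) ≤ t * B := Nat.mul_le_mul_left _ hγ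
    nlinarith
  calc S.card * A = ∑ x ∈ S, A := by simp
    _ ≤ ∑ x ∈ S, Ψ.roots.count x := Finset.sum_le_sum fun x hx => by
        rw [count_roots]; exact hroot x hx
    _ ≤ ∑ x ∈ S ∪ Ψ.roots.toFinset, Ψ.roots.count x :=
        Finset.sum_le_sum_of_subset Finset.subset_union_left
    _ = Ψ.roots.card := Multiset.sum_count_eq_card fun x hx => by simp at hx ⊢; tauto
    _ ≤ Ψ.natDegree := card_roots' _
    _ ≤ _ := hdeg

/-- Stepanov's bound: if `(x ^ t, (1 - x) ^ t)` takes at most `h` values on `S`, then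
`|S| ≪ (h t) ^ (2 / 3)`. -/
theorem card_pow_three_le_of_pow_values {t h : ℕ} (hh : 8 * h < t ^ 2)
    (hp : 64 * h * t ^ 4 ≤ p ^ 3) (S : Finset (ZMod p)) (h0 : ∀ x ∈ S, x ≠ 0 ∧ x ≠ 1)
    (H : Finset (ZMod p × ZMod p)) (hH : ∀ x ∈ S, (x ^ t, (1 - x) ^ t) ∈ H) (hHh : H.card ≤ h) :
    S.card ^ 3 ≤ 2 ^ 15 * h ^ 2 * t ^ 2 := by
  rcases Nat.eq_zero_or_pos h with rfl | hpos
  · have : S = ∅ := by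
      rw [Finset.card_eq_zero.1 (Nat.le_zero.1 hHh)] at hH
      exact Finset.eq_empty_of_forall_notMem fun x hx => by simpa using hH x hx
    simp [this]
  have ht : 0 < t := by by_contra! h'; interval_cases t; omega
  -- A is maximal with 8hA³ < t². With B = ⌊t/A⌋, so that t < 2AB, this inequality yields 2hA < B²;
  -- maximality bounds A from below. The cap t² on the search is harmless because a ≤ a³.
  set P : ℕ → Prop := fun A => 8 * h * A ^ 3 < t ^ 2 with hP
  have hP1 : P 1 := by simpa [hP] using hh
  set A := Nat.findGreatest P (t ^ 2) with hAdef
  have hPA : P A := Nat.findGreatest_spec (m := 1) (by nlinarith) hP1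
  have hA1 : 1 ≤ A := Nat.le_findGreatest (by nlinarith) hP1
  have hAt2 : ∀ a, P a → a ≤ A := by
    intro a ha
    refine Nat.le_findGreatest ?_ ha
    simp only [hP] at ha
    have : a ≤ a ^ 3 := Nat.le_self_pow (by norm_num) a
    nlinarith
  have hPA' : t ^ 2 ≤ 64 * h * A ^ 3 := by
    have h1 : ¬ P (A + 1) := fun h' => by have := hAt2 _ h'; omega
    simp only [hP, not_lt] at h1
    refine h1.trans ?_
    have h2 : (A + 1) ^ 3 ≤ (2 * A) ^ 3 := Nat.pow_le_pow_left (by omega) 3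
    calc 8 * h * (A + 1) ^ 3 ≤ 8 * h * (2 * A) ^ 3 := Nat.mul_le_mul_left _ h2
      _ = _ := by ring
  have hPA2 : 8 * h * A ^ 3 < t ^ 2 := hPA
  have hAt : A ≤ t := by
    have h1 : A ^ 2 ≤ A ^ 3 := Nat.pow_le_pow_right hA1 (by norm_num)
    have h2 : A ^ 2 ≤ t ^ 2 := by nlinarith
    exact (Nat.pow_le_pow_iff_left (by norm_num)).1 h2
  set B := t / A with hB
  have hB1 : 1 ≤ B := (Nat.one_le_div_iff (by omega)).2 hAt
  have hAB : A * B ≤ t := Nat.mul_div_le t A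
  have hAB' : t < 2 * (A * B) := by
    have : t < A * (B + 1) := by
      have := Nat.lt_mul_div_succ t (show 0 < A by omega)
      simpa [hB] using this
    nlinarith
  have hBt : B * t ≤ p := by
    by_contra! hlt
    have h1 : p ^ 3 < (B * t) ^ 3 := Nat.pow_lt_pow_left hlt (by norm_num)
    have h2 : p ^ 3 * t ^ 2 < 64 * h * t ^ 4 * t ^ 2 := by
      calc p ^ 3 * t ^ 2 < (B * t) ^ 3 * t ^ 2 := Nat.mul_lt_mul_of_pos_right h1 (by positivity)
        _ ≤ (B * t) ^ 3 * (64 * h * A ^ 3) := Nat.mul_le_mul_left _ hPA'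
        _ = 64 * h * t ^ 3 * (A * B) ^ 3 := by ring
        _ ≤ 64 * h * t ^ 3 * t ^ 3 := Nat.mul_le_mul_left _ (Nat.pow_le_pow_left hAB 3)
        _ = _ := by ring
    have := Nat.lt_of_mul_lt_mul_right h2
    omega
  have hcount : H.card * (2 * A) < B ^ 2 := by
    refine lt_of_le_of_lt (Nat.mul_le_mul_right _ hHh) ?_
    have h1 : t ^ 2 < (2 * (A * B)) ^ 2 := Nat.pow_lt_pow_left hAB' (by norm_num)
    have h2 : (4 * A ^ 2) * (h * (2 * A)) < (4 * A ^ 2) * B ^ 2 := by nlinarith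
    exact Nat.lt_of_mul_lt_mul_left h2
  have hN := card_mul_le_of_parameters hAt hAB hBt (by omega) S h0 H hH hcount
  have hN2 : S.card * A ^ 2 ≤ 2 * t ^ 2 := by
    calc S.card * A ^ 2 = (S.card * A) * A := by ring
      _ ≤ 2 * (B * t) * A := Nat.mul_le_mul_right _ hN
      _ = 2 * t * (A * B) := by ring
      _ ≤ 2 * t * t := Nat.mul_le_mul_left _ hAB
      _ = _ := by ring
  have hfin : S.card ^ 3 * t ^ 4 ≤ 2 ^ 15 * h ^ 2 * t ^ 2 * t ^ 4 := by
    calc S.card ^ 3 * t ^ 4 = S.card ^ 3 * (t ^ 2) ^ 2 := by ring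
      _ ≤ S.card ^ 3 * (64 * h * A ^ 3) ^ 2 :=
          Nat.mul_le_mul_left _ (Nat.pow_le_pow_left hPA' 2)
      _ = 4096 * h ^ 2 * (S.card * A ^ 2) ^ 3 := by ring
      _ ≤ 4096 * h ^ 2 * (2 * t ^ 2) ^ 3 := Nat.mul_le_mul_left _ (Nat.pow_le_pow_left hN2 3)
      _ = _ := by ring
  exact Nat.le_of_mul_le_mul_right hfin (by positivity)

end Stepanov

/-! ### Unions of cosets, shift counts and the third energy. -/

section Invariant

variable {p : ℕ} [Fact p.Prime] {Γ : Subgroup (ZMod p)ˣ}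

lemma mem_toFinset {x : ZMod p} : x ∈ toFinset Γ ↔ ∃ γ ∈ Γ, (γ : ZMod p) = x := by
  simp [toFinset]

lemma ne_zero_of_mem {x : ZMod p} (hx : x ∈ toFinset Γ) : x ≠ 0 := by
  obtain ⟨γ, -, rfl⟩ := mem_toFinset.1 hx
  exact γ.ne_zero

lemma card_toFinset (Γ : Subgroup (ZMod p)ˣ) : (toFinset Γ).card = Nat.card Γ := by
  have h : ((toFinset Γ : Finset (ZMod p)) : Set (ZMod p)) =
      (fun γ : (ZMod p)ˣ => (γ : ZMod p)) '' (Γ : Set (ZMod p)ˣ) := by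
    ext x
    simp [mem_toFinset]
  rw [← Set.ncard_coe_finset, h, Set.ncard_image_of_injective _ Units.val_injective]
  rfl

lemma card_pos_subgroup (Γ : Subgroup (ZMod p)ˣ) : 0 < Nat.card Γ := Nat.card_pos

lemma pow_card_eq_one {x : ZMod p} (hx : x ∈ toFinset Γ) : x ^ Nat.card Γ = 1 := by
  obtain ⟨γ, hγ, rfl⟩ := mem_toFinset.1 hx
  have : (⟨γ, hγ⟩ : Γ) ^ Nat.card Γ = 1 := pow_card_eq_one'
  have h := congrArg (fun y : Γ => ((y : (ZMod p)ˣ) : ZMod p)) this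
  simpa only [SubmonoidClass.coe_pow, Units.val_pow_eq_pow_val, OneMemClass.coe_one,
    Units.val_one] using h

lemma mul_mem_toFinset {x y : ZMod p} (hx : x ∈ toFinset Γ) (hy : y ∈ toFinset Γ) :
    x * y ∈ toFinset Γ := by
  obtain ⟨γ, hγ, rfl⟩ := mem_toFinset.1 hx
  obtain ⟨δ, hδ, rfl⟩ := mem_toFinset.1 hy
  exact mem_toFinset.2 ⟨γ * δ, Γ.mul_mem hγ hδ, by simp⟩

lemma inv_mem_toFinset {x : ZMod p} (hx : x ∈ toFinset Γ) : x⁻¹ ∈ toFinset Γ := by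
  obtain ⟨γ, hγ, rfl⟩ := mem_toFinset.1 hx
  exact mem_toFinset.2 ⟨γ⁻¹, Γ.inv_mem hγ, Units.val_inv_eq_inv_val γ⟩

/-- `R` is a union of cosets of `Γ` in `𝔽_p^*`. -/
structure IsInvariant (Γ : Subgroup (ZMod p)ˣ) (R : Finset (ZMod p)) : Prop where
  ne_zero : ∀ x ∈ R, x ≠ 0
  mul_mem : ∀ γ ∈ toFinset Γ, ∀ x ∈ R, γ * x ∈ R

/-- The number of cosets of `Γ` in an invariant set. -/
def cosets (Γ : Subgroup (ZMod p)ˣ) (R : Finset (ZMod p)) : ℕ :=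
  (R.image (· ^ Nat.card Γ)).card

lemma isInvariant_toFinset (Γ : Subgroup (ZMod p)ˣ) : IsInvariant Γ (toFinset Γ) :=
  ⟨fun _ => ne_zero_of_mem, fun _ h _ h' => mul_mem_toFinset h h'⟩

lemma IsInvariant.filter_pow {R : Finset (ZMod p)} (hR : IsInvariant Γ R) (V : Finset (ZMod p)) :
    IsInvariant Γ (R.filter fun z => z ^ Nat.card Γ ∈ V) := by
  refine ⟨fun x hx => hR.ne_zero x (Finset.mem_filter.1 hx).1, fun γ hγ x hx => ?_⟩
  rw [Finset.mem_filter] at hx ⊢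
  refine ⟨hR.mul_mem γ hγ x hx.1, ?_⟩
  rw [mul_pow, pow_card_eq_one hγ, one_mul]
  exact hx.2

/-- The fibres of z ↦ z^t on R are single cosets: z^t has at most t roots of order t, and Γz
supplies t of them. -/
lemma IsInvariant.card_eq {R : Finset (ZMod p)} (hR : IsInvariant Γ R) :
    R.card = Nat.card Γ * cosets Γ R := by
  rw [cosets, mul_comm]
  rw [Finset.card_eq_sum_card_image (· ^ Nat.card Γ) R, ← smul_eq_mul, ← Finset.sum_const]
  refine Finset.sum_congr rfl fun v hv => ?_
  obtain ⟨z, hz, rfl⟩ := Finset.mem_image.1 hv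
  apply le_antisymm
  · refine le_trans ?_ (Polynomial.card_nthRoots (Nat.card Γ) (z ^ Nat.card Γ))
    refine le_trans (Finset.card_le_card fun x hx => ?_) (Multiset.toFinset_card_le _)
    rw [Multiset.mem_toFinset, Polynomial.mem_nthRoots Nat.card_pos]
    exact (Finset.mem_filter.1 hx).2
  · refine ((card_toFinset Γ).symm.trans (Finset.card_image_of_injective (toFinset Γ)
      (mul_left_injective₀ (hR.ne_zero z hz))).symm).trans_le ?_
    refine Finset.card_le_card fun x hx => ?_
    obtain ⟨γ, hγ, rfl⟩ := Finset.mem_image.1 hx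
    refine Finset.mem_filter.2 ⟨hR.mul_mem γ hγ z hz, ?_⟩
    simp only [mul_pow]
    rw [pow_card_eq_one hγ, one_mul]

lemma cosets_toFinset (Γ : Subgroup (ZMod p)ˣ) : cosets Γ (toFinset Γ) = 1 := by
  have h := (isInvariant_toFinset Γ).card_eq
  rw [card_toFinset] at h
  exact Nat.eq_of_mul_eq_mul_left (card_pos_subgroup Γ) (by rw [← h, mul_one])

lemma IsInvariant.exists_subset {R : Finset (ZMod p)} (hR : IsInvariant Γ R) {K : ℕ}
    (hK : K ≤ cosets Γ R) : ∃ R' ⊆ R, IsInvariant Γ R' ∧ cosets Γ R' = K := by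
  obtain ⟨V, hV, hVK⟩ := Finset.exists_subset_card_eq hK
  refine ⟨_, Finset.filter_subset _ _, hR.filter_pow V, ?_⟩
  rw [cosets, ← hVK]
  congr 1
  ext v
  simp only [Finset.mem_image, Finset.mem_filter]
  constructor
  · rintro ⟨z, ⟨-, hz⟩, rfl⟩; exact hz
  · intro hv
    obtain ⟨z, hz, rfl⟩ := Finset.mem_image.1 (hV hv)
    exact ⟨z, ⟨hz, hv⟩, rfl⟩

lemma IsInvariant.sum_mul {R : Finset (ZMod p)} (hR : IsInvariant Γ R) {γ : ZMod p}
    (hγ : γ ∈ toFinset Γ) {M : Type*} [AddCommMonoid M] (f : ZMod p → M) :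
    ∑ x ∈ R, f (γ * x) = ∑ x ∈ R, f x := by
  refine Finset.sum_nbij' (γ * ·) (γ⁻¹ * ·) (fun x hx => hR.mul_mem γ hγ x hx)
    (fun x hx => hR.mul_mem _ (inv_mem_toFinset hγ) x hx) ?_ ?_ (fun _ _ => rfl)
  · intro x _; simp [ne_zero_of_mem hγ]
  · intro x _; simp [ne_zero_of_mem hγ]

/-- The number of `γ ∈ Γ` with `c * γ + z ∈ R`. -/
def shiftCount (Γ : Subgroup (ZMod p)ˣ) (R : Finset (ZMod p)) (c z : ZMod p) : ℕ :=
  ((toFinset Γ).filter fun γ => c * γ + z ∈ R).card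

lemma shiftCount_le (Γ : Subgroup (ZMod p)ˣ) (R : Finset (ZMod p)) (c z : ZMod p) :
    shiftCount Γ R c z ≤ Nat.card Γ :=
  (Finset.card_filter_le _ _).trans_eq (card_toFinset Γ)

lemma sum_shiftCount (Γ : Subgroup (ZMod p)ˣ) (R : Finset (ZMod p)) (c : ZMod p) :
    ∑ z, shiftCount Γ R c z = Nat.card Γ * R.card := by
  simp only [shiftCount, Finset.card_filter]
  rw [Finset.sum_comm]
  have : ∀ γ : ZMod p, ∑ z, (if c * γ + z ∈ R then 1 else 0) = R.card := by
    intro γ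
    exact (Fintype.sum_equiv (Equiv.addLeft (c * γ)) _ (fun z => if z ∈ R then 1 else 0)
      (fun z => rfl)).trans (by simp)
  simp [this, card_toFinset]

lemma shiftCount_mul {R : Finset (ZMod p)} (hR : IsInvariant Γ R) (c z : ZMod p) {δ : ZMod p}
    (hδ : δ ∈ toFinset Γ) : shiftCount Γ R c (δ * z) = shiftCount Γ R c z := by
  simp only [shiftCount, Finset.card_filter]
  rw [← (isInvariant_toFinset Γ).sum_mul hδ]
  refine Finset.sum_congr rfl fun γ _ => ?_
  have : c * (δ * γ) + δ * z = δ * (c * γ + z) := by ring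
  rw [this]
  congr 1
  refine propext ⟨fun h => ?_, fun h => hR.mul_mem _ hδ _ h⟩
  have := hR.mul_mem _ (inv_mem_toFinset hδ) _ h
  rwa [← mul_assoc, inv_mul_cancel₀ (ne_zero_of_mem hδ), one_mul] at this

lemma sum_shiftCount_invariant {R D : Finset (ZMod p)} (hR : IsInvariant Γ R)
    (hD : IsInvariant Γ D) (c : ZMod p) :
    ∑ z ∈ D, shiftCount Γ R c z = Nat.card Γ * (D.filter fun z => c + z ∈ R).card := by
  simp only [shiftCount, Finset.card_filter]
  rw [Finset.sum_comm, ← card_toFinset Γ, ← smul_eq_mul, ← Finset.sum_const]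
  refine Finset.sum_congr rfl fun γ hγ => ?_
  rw [← hD.sum_mul hγ]
  refine Finset.sum_congr rfl fun z _ => ?_
  have : c * γ + γ * z = γ * (c + z) := by ring
  rw [this]
  congr 1
  refine propext ⟨fun h => ?_, fun h => hR.mul_mem _ hγ _ h⟩
  have := hR.mul_mem _ (inv_mem_toFinset hγ) _ h
  rwa [← mul_assoc, inv_mul_cancel₀ (ne_zero_of_mem hγ), one_mul] at this

/-- Averaging over Γ produces at least |D/Γ|·m points z ∈ D with c + z ∈ R. For x = -z/c one has 1 -
x = (c+z)/c, so the pair of t-th powers takes at most |D/Γ|·|R/Γ| values and Stepanov's bound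
applies. -/
lemma cosets_mul_pow_three_le {R D : Finset (ZMod p)} (hR : IsInvariant Γ R)
    (hD : IsInvariant Γ D) {c : ZMod p} (hc : c ≠ 0) {m : ℕ}
    (hm : ∀ z ∈ D, m ≤ shiftCount Γ R c z)
    (h1 : 8 * (cosets Γ D * cosets Γ R) < Nat.card Γ ^ 2)
    (h2 : 64 * (cosets Γ D * cosets Γ R) * Nat.card Γ ^ 4 ≤ p ^ 3) :
    cosets Γ D * m ^ 3 ≤ 2 ^ 15 * cosets Γ R ^ 2 * Nat.card Γ ^ 2 := by
  set t := Nat.card Γ with ht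
  have htpos : 0 < t := card_pos_subgroup Γ
  set N := (D.filter fun z => c + z ∈ R) with hN
  have hmN : cosets Γ D * m ≤ N.card := by
    have h3 := sum_shiftCount_invariant hR hD c
    have h4 : D.card * m ≤ ∑ z ∈ D, shiftCount Γ R c z := by
      rw [← smul_eq_mul]; exact Finset.card_nsmul_le_sum _ _ _ hm
    rw [h3, hD.card_eq, mul_assoc] at h4
    exact Nat.le_of_mul_le_mul_left h4 htpos
  have hS : N.card ^ 3 ≤ 2 ^ 15 * (cosets Γ D * cosets Γ R) ^ 2 * t ^ 2 := by
    have hinj : Function.Injective fun z : ZMod p => -c⁻¹ * z :=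
      mul_right_injective₀ (neg_ne_zero.2 (inv_ne_zero hc))
    rw [← Finset.card_image_of_injective N hinj]
    refine card_pow_three_le_of_pow_values h1 h2 _ ?_
      (((D.image (· ^ t)) ×ˢ (R.image (· ^ t))).image
        fun v => ((-c⁻¹) ^ t * v.1, (c⁻¹) ^ t * v.2)) ?_ ?_
    · intro x hx
      obtain ⟨z, hz, rfl⟩ := Finset.mem_image.1 hx
      obtain ⟨hzD, hzR⟩ := Finset.mem_filter.1 hz
      refine ⟨mul_ne_zero (neg_ne_zero.2 (inv_ne_zero hc)) (hD.ne_zero z hzD), fun h => ?_⟩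
      refine hR.ne_zero _ hzR ?_
      have : z = -c := by field_simp at h; linear_combination -h
      rw [this]; ring
    · intro x hx
      obtain ⟨z, hz, rfl⟩ := Finset.mem_image.1 hx
      obtain ⟨hzD, hzR⟩ := Finset.mem_filter.1 hz
      refine Finset.mem_image.2 ⟨(z ^ t, (c + z) ^ t), Finset.mem_product.2
        ⟨Finset.mem_image_of_mem _ hzD, Finset.mem_image_of_mem _ hzR⟩, ?_⟩
      simp only [← mul_pow]
      have : c⁻¹ * (c + z) = 1 - -c⁻¹ * z := by field_simp; ring
      rw [this]
    · exact Finset.card_image_le.trans (Finset.card_product _ _).le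
  rcases Nat.eq_zero_or_pos (cosets Γ D) with h0 | hpos
  · simp [h0]
  have h5 : cosets Γ D ^ 2 * (cosets Γ D * m ^ 3) ≤
      cosets Γ D ^ 2 * (2 ^ 15 * cosets Γ R ^ 2 * t ^ 2) := by
    calc _ = (cosets Γ D * m) ^ 3 := by ring
      _ ≤ N.card ^ 3 := Nat.pow_le_pow_left hmN 3
      _ ≤ _ := hS
      _ = _ := by ring
  exact Nat.le_of_mul_le_mul_left h5 (by positivity)

/-- Summation over level sets: Markov's inequality handles low levels, and Stepanov's bound |D m| ≪
n² t³ / m³ handles high ones, where the harmonic sum creates the logarithm. -/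
lemma sum_shiftCount_pow_three_le {R : Finset (ZMod p)} (hR : IsInvariant Γ R) {c : ZMod p}
    (hc : c ≠ 0) (ht : 2 ≤ Nat.card Γ) (hn : cosets Γ R ≤ Nat.card Γ)
    (hp : cosets Γ R * Nat.card Γ ^ 3 ≤ p ^ 2) :
    ∑ z, (shiftCount Γ R c z : ℝ) ^ 3 ≤
      2 ^ 19 * (cosets Γ R : ℝ) ^ 2 * (Nat.card Γ : ℝ) ^ 3 * Real.logb 2 (Nat.card Γ) := by
  set t := Nat.card Γ with htdef
  set n := cosets Γ R with hndef
  have hL : 1 ≤ Real.logb 2 (t : ℝ) := by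
    rw [Real.le_logb_iff_rpow_le (by norm_num) (by positivity)]
    simpa using (show (2 : ℝ) ≤ (t : ℝ) by exact_mod_cast ht)
  have htR : (2 : ℝ) ≤ (t : ℝ) := by exact_mod_cast ht
  have hsum : ∑ z, shiftCount Γ R c z = t * (t * n) := by rw [sum_shiftCount, hR.card_eq]
  rcases Nat.eq_zero_or_pos n with hn0 | hnpos
  · rw [hn0, mul_zero, mul_zero, Finset.sum_eq_zero_iff] at hsum
    rw [Finset.sum_eq_zero fun z hz => by rw [hsum z hz]; simp]
    rw [hn0]; simp
  have hn1 : (1 : ℝ) ≤ (n : ℝ) := by exact_mod_cast hnpos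
  by_cases hsmall : Nat.sqrt (n * t) < 64
  · have h1 : n * t < 4096 := by
      have := Nat.lt_succ_sqrt (n * t)
      have h2 : (Nat.sqrt (n * t)).succ ≤ 64 := hsmall
      nlinarith
    have h2 : ∑ z, shiftCount Γ R c z ^ 3 ≤ t ^ 2 * (t * (t * n)) := by
      rw [← hsum, Finset.mul_sum]
      refine Finset.sum_le_sum fun z _ => ?_
      rw [pow_succ]
      exact Nat.mul_le_mul_right _ (Nat.pow_le_pow_left (shiftCount_le Γ R c z) 2)
    have h3 : t ^ 2 * (t * (t * n)) ≤ 4096 * t ^ 3 := by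
      calc _ = (n * t) * t ^ 3 := by ring
        _ ≤ _ := Nat.mul_le_mul_right _ h1.le
    have h4 : ∑ z, (shiftCount Γ R c z : ℝ) ^ 3 ≤ 4096 * (t : ℝ) ^ 3 := by
      exact_mod_cast h2.trans h3
    have h5 : (1 : ℝ) ≤ (n : ℝ) ^ 2 * Real.logb 2 t := one_le_mul_of_one_le_of_one_le
      (one_le_pow₀ hn1) hL
    nlinarith [pow_pos (show (0 : ℝ) < t by linarith) 3]
  -- K is of the order of the largest number of cosets that both size conditions of Stepanov's bound
  -- allow, given n ≤ t and n t³ ≤ p². The case nt < 4096, where K could be 0, is already settled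
  -- trivially.
  set K := Nat.sqrt (n * t) / 64 with hKdef
  have hs1 : Nat.sqrt (n * t) * Nat.sqrt (n * t) ≤ n * t := Nat.sqrt_le _
  have hs2 : n * t < (Nat.sqrt (n * t) + 1) * (Nat.sqrt (n * t) + 1) := Nat.lt_succ_sqrt _
  have hK1 : 64 * K ≤ Nat.sqrt (n * t) := Nat.mul_div_le _ _
  have hK2 : Nat.sqrt (n * t) + 1 ≤ 128 * K + 1 := by omega
  have hKpos : 1 ≤ K := by omega
  have hKnt : (64 * K) ^ 2 ≤ n * t := by nlinarith
  have hKnt' : n * t ≤ 2 ^ 16 * K ^ 2 := by nlinarith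
  have hc1 : 8 * (K * n) < t ^ 2 := by
    have h1 : (64 * (K * n)) ^ 2 ≤ (t ^ 2) ^ 2 := by
      calc _ = (64 * K) ^ 2 * n ^ 2 := by ring
        _ ≤ n * t * n ^ 2 := Nat.mul_le_mul_right _ hKnt
        _ = n ^ 3 * t := by ring
        _ ≤ t ^ 3 * t := Nat.mul_le_mul_right _ (Nat.pow_le_pow_left hn 3)
        _ = _ := by ring
    have h2 := (Nat.pow_le_pow_iff_left (by norm_num)).1 h1
    have : 0 < K * n := Nat.mul_pos hKpos hnpos
    omega
  have hc2 : 64 * (K * n) * t ^ 4 ≤ p ^ 3 := by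
    have h1 : (64 * (K * n) * t ^ 4) ^ 2 ≤ (p ^ 3) ^ 2 := by
      calc _ = (64 * K) ^ 2 * (n ^ 2 * t ^ 8) := by ring
        _ ≤ n * t * (n ^ 2 * t ^ 8) := Nat.mul_le_mul_right _ hKnt
        _ = (n * t ^ 3) ^ 3 := by ring
        _ ≤ (p ^ 2) ^ 3 := Nat.pow_le_pow_left hp 3
        _ = _ := by ring
    exact (Nat.pow_le_pow_iff_left (by norm_num)).1 h1
  set D : ℕ → Finset (ZMod p) := fun m =>
    Finset.univ.filter fun z => z ≠ 0 ∧ m ≤ shiftCount Γ R c z with hDdef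
  have hDinv : ∀ m, IsInvariant Γ (D m) := by
    intro m
    refine ⟨fun z hz => (Finset.mem_filter.1 hz).2.1, fun γ hγ z hz => ?_⟩
    obtain ⟨-, hz0, hzm⟩ := Finset.mem_filter.1 hz
    refine Finset.mem_filter.2 ⟨Finset.mem_univ _, mul_ne_zero (ne_zero_of_mem hγ) hz0, ?_⟩
    rwa [shiftCount_mul hR c z hγ]
  have hlarge : ∀ m, 2 ^ 15 * n ^ 2 * t ^ 2 < K * m ^ 3 →
      cosets Γ (D m) * m ^ 3 ≤ 2 ^ 15 * n ^ 2 * t ^ 2 := by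
    intro m hm
    have hmem : ∀ z ∈ D m, m ≤ shiftCount Γ R c z := fun z hz => (Finset.mem_filter.1 hz).2.2
    have hlt : cosets Γ (D m) ≤ K := by
      -- With more than K cosets, a subset of exactly K would satisfy the size conditions and
      -- contradict the lower bound on m.
      by_contra! hlt
      obtain ⟨D', hD', hinv, hcard⟩ := (hDinv m).exists_subset hlt.le
      have := cosets_mul_pow_three_le hR hinv hc (fun z hz => hmem z (hD' hz))
        (by rw [hcard]; exact hc1) (by rw [hcard]; exact hc2)
      rw [hcard] at this
      exact absurd (lt_of_lt_of_le hm this) (lt_irrefl _)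
    refine cosets_mul_pow_three_le hR (hDinv m) hc hmem ?_ ?_
    · exact lt_of_le_of_lt (Nat.mul_le_mul_left _ (Nat.mul_le_mul_right _ hlt)) hc1
    · exact le_trans (Nat.mul_le_mul_right _ (Nat.mul_le_mul_left _
        (Nat.mul_le_mul_right _ hlt))) hc2
  have hmarkov : ∀ m, m * (D m).card ≤ n * t ^ 2 := by
    intro m
    calc m * (D m).card = ∑ z ∈ D m, m := by simp [mul_comm]
      _ ≤ ∑ z ∈ D m, shiftCount Γ R c z :=
          Finset.sum_le_sum fun z hz => (Finset.mem_filter.1 hz).2.2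
      _ ≤ ∑ z, shiftCount Γ R c z := Finset.sum_le_sum_of_subset (Finset.subset_univ _)
      _ = n * t ^ 2 := by rw [hsum]; ring
  -- Above this level K m³ exceeds 2¹⁵ n² t², since K² ≥ nt / 2¹⁶.
  set m₀ := Nat.sqrt (2 ^ 16 * (n * t)) with hm₀
  have hm₀sq : (m₀ : ℝ) * m₀ ≤ 2 ^ 16 * (n * t) := by exact_mod_cast Nat.sqrt_le (2 ^ 16 * (n * t))
  have hm₀large : ∀ m, m₀ < m → 2 ^ 15 * n ^ 2 * t ^ 2 < K * m ^ 3 := by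
    intro m hm
    by_contra! hle
    have h1 : 2 ^ 16 * (n * t) < m ^ 2 := by rw [pow_two]; exact Nat.sqrt_lt.1 hm
    have h2 : (2 ^ 16 * (n * t)) ^ 3 * (n * t) < (2 ^ 16 * (n * t)) ^ 3 * (n * t) := by
      calc (2 ^ 16 * (n * t)) ^ 3 * (n * t) < (m ^ 2) ^ 3 * (n * t) :=
            Nat.mul_lt_mul_of_pos_right (Nat.pow_lt_pow_left h1 (by norm_num)) (by positivity)
        _ ≤ (m ^ 2) ^ 3 * (2 ^ 16 * K ^ 2) := Nat.mul_le_mul_left _ hKnt'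
        _ = 2 ^ 16 * (K * m ^ 3) ^ 2 := by ring
        _ ≤ 2 ^ 16 * (2 ^ 15 * n ^ 2 * t ^ 2) ^ 2 :=
            Nat.mul_le_mul_left _ (Nat.pow_le_pow_left hle 2)
        _ = 2 ^ 46 * (n * t) ^ 4 := by ring
        _ ≤ 2 ^ 48 * (n * t) ^ 4 := Nat.mul_le_mul_right _ (by norm_num)
        _ = (2 ^ 16 * (n * t)) ^ 3 * (n * t) := by ring
    exact lt_irrefl _ h2
  have hterm : ∀ m ∈ Finset.Icc 1 t, 3 * (m : ℝ) ^ 2 * (D m).card ≤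
      (if m ≤ m₀ then 3 * m₀ * (n * t ^ 2 : ℝ) else 0) +
        3 * 2 ^ 15 * n ^ 2 * t ^ 3 * (m : ℝ)⁻¹ := by
    intro m hm
    have hm1 : (1 : ℝ) ≤ m := by exact_mod_cast (Finset.mem_Icc.1 hm).1
    split_ifs with h
    · have h1 : (m : ℝ) * (D m).card ≤ n * t ^ 2 := by exact_mod_cast hmarkov m
      have h2 : (m : ℝ) ≤ m₀ := by exact_mod_cast h
      have h3 : 3 * (m : ℝ) ^ 2 * (D m).card ≤ 3 * m₀ * (n * t ^ 2 : ℝ) := by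
        calc 3 * (m : ℝ) ^ 2 * (D m).card = 3 * m * (m * (D m).card) := by ring
          _ ≤ 3 * m₀ * (n * t ^ 2) := by gcongr
      have h4 : (0 : ℝ) ≤ 3 * 2 ^ 15 * n ^ 2 * t ^ 3 * (m : ℝ)⁻¹ := by positivity
      linarith
    · have h1 : (cosets Γ (D m) : ℝ) * m ^ 3 ≤ 2 ^ 15 * n ^ 2 * t ^ 2 := by
        exact_mod_cast hlarge m (hm₀large m (by omega))
      rw [zero_add, (hDinv m).card_eq, ← div_eq_mul_inv, le_div_iff₀ (by linarith)]
      push_cast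
      rw [← htdef]
      calc 3 * (m : ℝ) ^ 2 * (t * cosets Γ (D m)) * (m : ℝ) = 3 * t * (cosets Γ (D m) * (m : ℝ) ^ 3) := by ring
        _ ≤ 3 * t * (2 ^ 15 * (n : ℝ) ^ 2 * t ^ 2) := by gcongr
        _ = _ := by ring
  have hlayer : ∀ k : ℕ, (k : ℝ) ^ 3 ≤ ∑ m ∈ Finset.Icc 1 k, 3 * (m : ℝ) ^ 2 := by
    intro k
    induction k with
    | zero => simp
    | succ k ih =>
      rw [Finset.sum_Icc_succ_top (by omega)]
      push_cast
      nlinarith [(k.cast_nonneg : (0 : ℝ) ≤ k)]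
  have hnonzero : ∑ z ∈ Finset.univ.erase (0 : ZMod p), (shiftCount Γ R c z : ℝ) ^ 3 ≤
      ∑ m ∈ Finset.Icc 1 t, 3 * (m : ℝ) ^ 2 * (D m).card := by
    have h1 : ∀ z : ZMod p, (shiftCount Γ R c z : ℝ) ^ 3 ≤
        ∑ m ∈ Finset.Icc 1 t, if m ≤ shiftCount Γ R c z then 3 * (m : ℝ) ^ 2 else 0 := by
      intro z
      refine (hlayer _).trans (le_of_eq ?_)
      rw [← Finset.sum_filter]
      congr 1
      ext m
      have := shiftCount_le Γ R c z
      simp only [Finset.mem_Icc, Finset.mem_filter]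
      omega
    refine (Finset.sum_le_sum fun z _ => h1 z).trans (le_of_eq ?_)
    rw [Finset.sum_comm]
    refine Finset.sum_congr rfl fun m _ => ?_
    rw [← Finset.sum_filter, Finset.sum_const, nsmul_eq_mul, mul_comm]
    congr 3
    ext z
    simp [hDdef]
  have hharm : ∑ m ∈ Finset.Icc 1 t, (m : ℝ)⁻¹ ≤ 2 * Real.logb 2 t := by
    have h1 := harmonic_le_one_add_log t
    rw [harmonic_eq_sum_Icc] at h1
    push_cast at h1
    have h2 : Real.log t ≤ Real.logb 2 t := by
      rw [Real.logb, le_div_iff₀ (Real.log_pos (by norm_num))]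
      have := Real.log_two_lt_d9
      have h3 : 0 ≤ Real.log t := Real.log_nonneg (by linarith)
      nlinarith
    linarith
  have hA : ∑ m ∈ Finset.Icc 1 t, (if m ≤ m₀ then 3 * m₀ * (n * t ^ 2 : ℝ) else 0) ≤
      3 * 2 ^ 16 * (n ^ 2 * t ^ 3) := by
    rw [← Finset.sum_filter, Finset.sum_const, nsmul_eq_mul]
    have h1 : ((Finset.Icc 1 t).filter (· ≤ m₀)).card ≤ m₀ := by
      refine (Finset.card_le_card (t := Finset.Icc 1 m₀) fun m hm => ?_).trans (by simp)
      simp only [Finset.mem_filter, Finset.mem_Icc] at hm ⊢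
      omega
    have h1' : (((Finset.Icc 1 t).filter (· ≤ m₀)).card : ℝ) ≤ m₀ := by exact_mod_cast h1
    calc _ ≤ (m₀ : ℝ) * (3 * m₀ * (n * t ^ 2 : ℝ)) := by gcongr
      _ = 3 * (m₀ * m₀) * (n * t ^ 2) := by ring
      _ ≤ 3 * (2 ^ 16 * (n * t)) * (n * t ^ 2) := by gcongr
      _ = _ := by ring
  have hB : ∑ m ∈ Finset.Icc 1 t, 3 * 2 ^ 15 * (n : ℝ) ^ 2 * t ^ 3 * (m : ℝ)⁻¹ ≤
      3 * 2 ^ 15 * (n : ℝ) ^ 2 * t ^ 3 * (2 * Real.logb 2 t) := by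
    rw [← Finset.mul_sum]
    gcongr
  have hzero : (shiftCount Γ R c 0 : ℝ) ^ 3 ≤ n ^ 2 * t ^ 3 := by
    have h1 : (shiftCount Γ R c 0 : ℝ) ≤ t := by exact_mod_cast shiftCount_le Γ R c 0
    calc _ ≤ (t : ℝ) ^ 3 := by gcongr
      _ ≤ n ^ 2 * t ^ 3 := le_mul_of_one_le_left (by positivity) (one_le_pow₀ hn1)
  have hX : (n : ℝ) ^ 2 * t ^ 3 ≤ n ^ 2 * t ^ 3 * Real.logb 2 t :=
    le_mul_of_one_le_right (by positivity) hL
  have htot := (Finset.sum_le_sum hterm).trans_eq Finset.sum_add_distrib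
  rw [← Finset.add_sum_erase _ _ (Finset.mem_univ (0 : ZMod p))]
  have hpos : (0 : ℝ) ≤ n ^ 2 * t ^ 3 := by positivity
  linarith

/-- The number of representations of `z` as a difference of elements of `A`. -/
def diffCount (A : Finset (ZMod p)) (z : ZMod p) : ℕ := (A.filter fun y => y + z ∈ A).card

/-- The third moment of the number of representations by differences. -/
def thirdEnergy (A : Finset (ZMod p)) : ℕ := ∑ z, diffCount A z ^ 3

lemma card_mul_diffCount {R : Finset (ZMod p)} (hR : IsInvariant Γ R) (z : ZMod p) :
    Nat.card Γ * diffCount R z = ∑ c ∈ R, shiftCount Γ R c z := by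
  simp only [shiftCount, diffCount, Finset.card_filter]
  rw [Finset.sum_comm, ← card_toFinset Γ, ← smul_eq_mul, ← Finset.sum_const]
  refine Finset.sum_congr rfl fun γ hγ => ?_
  rw [← hR.sum_mul hγ]
  simp only [mul_comm γ]

/-- By invariance t · `diffCount` is the sum of the shift counts over c ∈ R. The power mean
inequality passes to cubes at the cost of |R|², and each c is bounded separately. -/
lemma thirdEnergy_le {R : Finset (ZMod p)} (hR : IsInvariant Γ R) (ht : 2 ≤ Nat.card Γ)
    (hn : cosets Γ R ≤ Nat.card Γ) (hp : cosets Γ R * Nat.card Γ ^ 3 ≤ p ^ 2) :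
    (thirdEnergy R : ℝ) ≤
      2 ^ 19 * (cosets Γ R : ℝ) ^ 5 * (Nat.card Γ : ℝ) ^ 3 * Real.logb 2 (Nat.card Γ) := by
  set t := Nat.card Γ with htdef
  set n := cosets Γ R with hndef
  have hRcard : (R.card : ℝ) = t * n := by exact_mod_cast hR.card_eq
  have h1 : ∀ z, (t : ℝ) ^ 3 * (diffCount R z : ℝ) ^ 3 ≤
      (R.card : ℝ) ^ 2 * ∑ c ∈ R, (shiftCount Γ R c z : ℝ) ^ 3 := by
    intro z
    have h2 : (t : ℝ) * diffCount R z = ∑ c ∈ R, (shiftCount Γ R c z : ℝ) := by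
      exact_mod_cast card_mul_diffCount hR z
    rw [← mul_pow, h2]
    rcases R.eq_empty_or_nonempty with rfl | hne
    · simp
    rw [← div_le_iff₀' (by have := hne.card_pos; positivity)]
    exact pow_sum_div_card_le_sum_pow (fun c _ => Nat.cast_nonneg _) 2
  have h3 : (t : ℝ) ^ 3 * thirdEnergy R ≤ (t : ℝ) ^ 3 *
      (2 ^ 19 * (n : ℝ) ^ 5 * (t : ℝ) ^ 3 * Real.logb 2 t) := by
    calc (t : ℝ) ^ 3 * thirdEnergy R = ∑ z, (t : ℝ) ^ 3 * (diffCount R z : ℝ) ^ 3 := by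
          rw [thirdEnergy, Nat.cast_sum, Finset.mul_sum]; push_cast; rfl
      _ ≤ ∑ z, (R.card : ℝ) ^ 2 * ∑ c ∈ R, (shiftCount Γ R c z : ℝ) ^ 3 :=
          Finset.sum_le_sum fun z _ => h1 z
      _ = (R.card : ℝ) ^ 2 * ∑ c ∈ R, ∑ z, (shiftCount Γ R c z : ℝ) ^ 3 := by
          rw [← Finset.mul_sum, Finset.sum_comm]
      _ ≤ (R.card : ℝ) ^ 2 * ∑ c ∈ R,
          (2 ^ 19 * (n : ℝ) ^ 2 * (t : ℝ) ^ 3 * Real.logb 2 t) := by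
          gcongr with c hc
          exact sum_shiftCount_pow_three_le hR (hR.ne_zero c hc) ht hn hp
      _ = _ := by rw [Finset.sum_const, nsmul_eq_mul, hRcard]; ring
  exact le_of_mul_le_mul_left h3 (by positivity)

end Invariant

/-! ### Parseval identities and the spectral inequality. -/

section Fourier

variable {p : ℕ} [Fact p.Prime]

open ComplexConjugate

/-- The exponential sum `∑_{x ∈ A} e(x ξ)`. -/
def charSum (A : Finset (ZMod p)) (ξ : ZMod p) : ℂ := ∑ x ∈ A, ZMod.stdAddChar (x * ξ)

lemma sum_stdAddChar (a : ZMod p) :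
    ∑ ξ : ZMod p, (ZMod.stdAddChar (a * ξ) : ℂ) = if a = 0 then (p : ℂ) else 0 := by
  have := AddChar.sum_mulShift a (ZMod.isPrimitive_stdAddChar p)
  rw [ZMod.card] at this
  simpa [mul_comm] using this

lemma conj_stdAddChar (a : ZMod p) :
    conj (ZMod.stdAddChar a : ℂ) = ZMod.stdAddChar (-a) :=
  (AddChar.map_neg_eq_conj _ _).symm

lemma sum_norm_sq_stdAddChar {ι : Type*} (I : Finset ι) (φ₁ φ₂ : ι → ZMod p) :
    ∑ w : ZMod p × ZMod p, ‖∑ i ∈ I, (ZMod.stdAddChar (φ₁ i * w.1 + φ₂ i * w.2) : ℂ)‖ ^ 2 =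
      (p : ℝ) ^ 2 * ((I ×ˢ I).filter fun x => φ₁ x.1 = φ₁ x.2 ∧ φ₂ x.1 = φ₂ x.2).card := by
  have h1 : ∀ i j : ι, ∑ w : ZMod p × ZMod p,
      (ZMod.stdAddChar (φ₁ i * w.1 + φ₂ i * w.2) : ℂ) *
        conj (ZMod.stdAddChar (φ₁ j * w.1 + φ₂ j * w.2) : ℂ) =
      if φ₁ i = φ₁ j ∧ φ₂ i = φ₂ j then (p : ℂ) ^ 2 else 0 := by
    intro i j
    have h2 : ∀ w : ZMod p × ZMod p, (ZMod.stdAddChar (φ₁ i * w.1 + φ₂ i * w.2) : ℂ) *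
        conj (ZMod.stdAddChar (φ₁ j * w.1 + φ₂ j * w.2) : ℂ) =
        ZMod.stdAddChar ((φ₁ i - φ₁ j) * w.1) * ZMod.stdAddChar ((φ₂ i - φ₂ j) * w.2) := by
      intro w
      rw [conj_stdAddChar, ← AddChar.map_add_eq_mul, ← AddChar.map_add_eq_mul]
      congr 1; ring
    simp only [h2]
    rw [Fintype.sum_prod_type]
    simp only
    rw [← Fintype.sum_mul_sum, sum_stdAddChar, sum_stdAddChar]
    simp only [sub_eq_zero]
    split_ifs <;> simp_all [pow_two]
  have h3 : ((∑ w : ZMod p × ZMod p,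
      ‖∑ i ∈ I, (ZMod.stdAddChar (φ₁ i * w.1 + φ₂ i * w.2) : ℂ)‖ ^ 2 : ℝ) : ℂ) =
      (((p : ℝ) ^ 2 * ((I ×ˢ I).filter fun x => φ₁ x.1 = φ₁ x.2 ∧ φ₂ x.1 = φ₂ x.2).card : ℝ) : ℂ) := by
    push_cast
    simp only [← Complex.mul_conj', map_sum, Finset.sum_mul_sum]
    rw [Finset.sum_comm, Finset.card_filter, Finset.sum_product]
    push_cast
    rw [Finset.mul_sum]
    refine Finset.sum_congr rfl fun i _ => ?_
    rw [Finset.sum_comm, Finset.mul_sum]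
    refine Finset.sum_congr rfl fun j _ => ?_
    rw [h1]
    simp
  exact_mod_cast h3

lemma sum_norm_charSum_pow_four (A : Finset (ZMod p)) :
    ∑ ξ, ‖charSum A ξ‖ ^ 4 = p * energy A := by
  -- The second frequency is a dummy; it contributes a factor p that is cancelled at the end.
  have h1 := sum_norm_sq_stdAddChar (A ×ˢ A) (fun x => x.1 + x.2) (fun _ => 0)
  have h2 : ((A ×ˢ A) ×ˢ (A ×ˢ A)).filter
      (fun x => x.1.1 + x.1.2 = x.2.1 + x.2.2 ∧ (0 : ZMod p) = 0) =
      ((A ×ˢ A) ×ˢ (A ×ˢ A)).filter (fun x => x.1.1 + x.1.2 = x.2.1 + x.2.2) := by simp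
  rw [h2, ← Finset.addEnergy_eq_card_filter, Fintype.sum_prod_type] at h1
  have h3 : ∀ ξ : ZMod p, (∑ i ∈ A ×ˢ A, (ZMod.stdAddChar ((i.1 + i.2) * ξ) : ℂ)) =
      charSum A ξ ^ 2 := by
    intro ξ
    rw [charSum, pow_two, Finset.sum_mul_sum, Finset.sum_product]
    simp only [← AddChar.map_add_eq_mul, add_mul]
  simp only [zero_mul, add_zero, h3, Finset.sum_const, Finset.card_univ, ZMod.card,
    nsmul_eq_mul, norm_pow, ← pow_mul, ← Finset.mul_sum] at h1
  have hp : (p : ℝ) ≠ 0 := by exact_mod_cast (Fact.out : p.Prime).ne_zero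
  refine mul_left_cancel₀ hp ?_
  rw [h1, energy]; ring

/-- Pairs of triples in `A` with the same differences are counted by `thirdEnergy`. -/
lemma card_filter_triples (A : Finset (ZMod p)) :
    (((A ×ˢ A ×ˢ A) ×ˢ (A ×ˢ A ×ˢ A)).filter fun x => x.1.1 - x.1.2.1 = x.2.1 - x.2.2.1 ∧
      x.1.2.2 - x.1.1 = x.2.2.2 - x.2.1).card = thirdEnergy A := by
  rw [thirdEnergy, Finset.card_eq_sum_card_fiberwise (f := fun x => x.2.1 - x.1.1)
    (t := Finset.univ) (fun _ _ => Finset.mem_coe.2 (Finset.mem_univ _))]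
  refine Finset.sum_congr rfl fun z _ => ?_
  have : diffCount A z ^ 3 = ((A.filter fun y => y + z ∈ A) ×ˢ (A.filter fun y => y + z ∈ A) ×ˢ
      (A.filter fun y => y + z ∈ A)).card := by
    rw [Finset.card_product, Finset.card_product, diffCount]; ring
  rw [this]
  refine Finset.card_nbij' (fun x => x.1)
    (fun x => (x, (x.1 + z, x.2.1 + z, x.2.2 + z))) ?_ ?_ ?_ ?_
  · rintro ⟨⟨x, y, w⟩, x', y', w'⟩ h
    simp only [Finset.coe_filter, Finset.mem_filter, Finset.mem_product, Set.mem_ofPred_eq,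
      Finset.coe_product, Set.mem_prod] at h ⊢
    obtain ⟨⟨⟨⟨h1, h2, h3⟩, h4, h5, h6⟩, h7, h8⟩, h9⟩ := h
    have e1 : x + z = x' := by linear_combination -h9
    have e2 : y + z = y' := by linear_combination -h9 - h7
    have e3 : w + z = w' := by linear_combination -h9 + h8
    rw [e1, e2, e3]
    exact ⟨⟨h1, h4⟩, ⟨h2, h5⟩, ⟨h3, h6⟩⟩
  · rintro ⟨x, y, w⟩ h
    simp only [Finset.coe_filter, Finset.mem_filter, Finset.mem_product, Set.mem_ofPred_eq,
      Finset.coe_product, Set.mem_prod] at h ⊢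
    obtain ⟨⟨h1, h4⟩, ⟨h2, h5⟩, ⟨h3, h6⟩⟩ := h
    refine ⟨⟨⟨⟨h1, h2, h3⟩, h4, h5, h6⟩, ?_, ?_⟩, ?_⟩ <;> ring
  · rintro ⟨⟨x, y, w⟩, x', y', w'⟩ h
    simp only [Finset.coe_filter, Finset.mem_filter, Finset.mem_product, Set.mem_ofPred_eq] at h
    obtain ⟨⟨⟨⟨h1, h2, h3⟩, h4, h5, h6⟩, h7, h8⟩, h9⟩ := h
    simp only [Prod.mk.injEq, true_and]
    refine ⟨?_, ?_, ?_⟩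
    · linear_combination -h9
    · linear_combination -h9 - h7
    · linear_combination -h9 + h8
  · rintro ⟨x, y, w⟩ _; rfl

lemma sum_card_filter_sq {ι κ : Type*} [Fintype κ] [DecidableEq κ] (I : Finset ι) (φ : ι → κ) :
    ∑ w, (I.filter fun i => φ i = w).card ^ 2 =
      ((I ×ˢ I).filter fun x => φ x.1 = φ x.2).card := by
  rw [Finset.card_eq_sum_card_fiberwise (f := fun x => φ x.1) (t := Finset.univ)
    (fun _ _ => Finset.mem_coe.2 (Finset.mem_univ _))]
  refine Finset.sum_congr rfl fun w _ => ?_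
  rw [pow_two, ← Finset.card_product]
  congr 1
  ext x
  simp only [Finset.mem_product, Finset.mem_filter]
  constructor
  · rintro ⟨⟨h1, h2⟩, h3, h4⟩; exact ⟨⟨⟨h1, h3⟩, h2.trans h4.symm⟩, h2⟩
  · rintro ⟨⟨⟨h1, h3⟩, h5⟩, h2⟩; exact ⟨⟨h1, h2⟩, h3, h5 ▸ h2⟩

/-- The sum `∑_{x, y, y' ∈ A} ∑_{a, b, b' ∈ B} e((a - b)(y - x) + (b' - a)(y' - x))`. -/
def sixfoldSum (A B : Finset (ZMod p)) : ℂ :=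
  ∑ i ∈ A ×ˢ A ×ˢ A, ∑ k ∈ B ×ˢ B ×ˢ B,
    ZMod.stdAddChar ((k.1 - k.2.1) * (i.2.1 - i.1) + (k.2.2 - k.1) * (i.2.2 - i.1))

/-- Triples from A are grouped by their two differences and Cauchy–Schwarz is applied. The
multiplicities have second moment E₃(A), and Parseval on 𝔽_p² gives p² E₃(B) for the other factor.
-/
lemma norm_sixfoldSum_sq_le (A B : Finset (ZMod p)) :
    ‖sixfoldSum A B‖ ^ 2 ≤ (p : ℝ) ^ 2 * thirdEnergy A * thirdEnergy B := by
  set H : ZMod p × ZMod p → ℂ := fun w => ∑ k ∈ B ×ˢ B ×ˢ B,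
    ZMod.stdAddChar ((k.1 - k.2.1) * w.1 + (k.2.2 - k.1) * w.2) with hH
  set φ : ZMod p × ZMod p × ZMod p → ZMod p × ZMod p := fun i => (i.2.1 - i.1, i.2.2 - i.1) with hφ
  set N : ZMod p × ZMod p → ℕ := fun w => ((A ×ˢ A ×ˢ A).filter fun i => φ i = w).card with hN
  have h1 : sixfoldSum A B = ∑ w, (N w : ℂ) * H w := by
    have h2 : sixfoldSum A B = ∑ i ∈ A ×ˢ A ×ˢ A, H (φ i) := rfl
    rw [h2, ← Finset.sum_fiberwise (A ×ˢ A ×ˢ A) φ]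
    refine Finset.sum_congr rfl fun w _ => ?_
    rw [← nsmul_eq_mul, hN, ← Finset.sum_const]
    exact Finset.sum_congr rfl fun i hi => by rw [(Finset.mem_filter.1 hi).2]
  have hN2 : ∑ w, (N w : ℝ) ^ 2 = thirdEnergy A := by
    have := sum_card_filter_sq (A ×ˢ A ×ˢ A) φ
    rw [← card_filter_triples]
    have h3 : ∑ w, N w ^ 2 = _ := this
    rw [← Nat.cast_inj (R := ℝ)] at h3
    push_cast at h3
    rw [h3]
    congr 2
    ext x
    simp only [hφ, Finset.mem_filter, Prod.mk.injEq]
    refine and_congr_right fun _ => and_congr_left fun _ => ?_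
    rw [← neg_sub x.1.1, ← neg_sub x.2.1, neg_inj]
  have hH2 : ∑ w, ‖H w‖ ^ 2 = (p : ℝ) ^ 2 * thirdEnergy B := by
    rw [← card_filter_triples]
    exact sum_norm_sq_stdAddChar (B ×ˢ B ×ˢ B) (fun k => k.1 - k.2.1) (fun k => k.2.2 - k.1)
  calc ‖sixfoldSum A B‖ ^ 2 ≤ (∑ w, (N w : ℝ) * ‖H w‖) ^ 2 := by
        gcongr
        rw [h1]
        refine (norm_sum_le _ _).trans (le_of_eq ?_)
        simp
    _ ≤ (∑ w, (N w : ℝ) ^ 2) * ∑ w, ‖H w‖ ^ 2 := Finset.sum_mul_sq_le_sq_mul_sq _ _ _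
    _ = _ := by rw [hN2, hH2]; ring

variable {Γ : Subgroup (ZMod p)ˣ}

lemma charSum_mul {γ : ZMod p} (hγ : γ ∈ toFinset Γ) (ξ : ZMod p) :
    charSum (toFinset Γ) (γ * ξ) = charSum (toFinset Γ) ξ := by
  rw [charSum, charSum, ← (isInvariant_toFinset Γ).sum_mul hγ
    (fun x => (ZMod.stdAddChar (x * ξ) : ℂ))]
  exact Finset.sum_congr rfl fun x _ => by congr 1; ring

/-- Invariance of R and of the character sum makes the left side independent of y ∈ Γ, so it equals
its average over Γ. This is the eigenvector equation for M*M. -/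
lemma sum_stdAddChar_mul_charSum {R : Finset (ZMod p)} (hR : IsInvariant Γ R) {y : ZMod p}
    (hy : y ∈ toFinset Γ) :
    ∑ b ∈ R, ZMod.stdAddChar (-(b * y)) * charSum (toFinset Γ) b =
      (((∑ b ∈ R, ‖charSum (toFinset Γ) b‖ ^ 2) / Nat.card Γ : ℝ) : ℂ) := by
  set f : ZMod p → ℂ := fun y => ∑ b ∈ R, ZMod.stdAddChar (-(b * y)) * charSum (toFinset Γ) b
    with hf
  have hconst : ∀ y ∈ toFinset Γ, f y = f 1 := by
    intro y hy
    simp only [hf]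
    rw [← hR.sum_mul hy (fun b => ZMod.stdAddChar (-(b * 1)) * charSum (toFinset Γ) b)]
    refine Finset.sum_congr rfl fun b _ => ?_
    rw [charSum_mul hy]
    congr 2; ring
  have hsum : ∑ y ∈ toFinset Γ, f y = ((∑ b ∈ R, ‖charSum (toFinset Γ) b‖ ^ 2 : ℝ) : ℂ) := by
    simp only [hf]
    rw [Finset.sum_comm]
    push_cast
    refine Finset.sum_congr rfl fun b _ => ?_
    rw [← Finset.sum_mul, ← Complex.conj_mul']
    congr 1
    rw [charSum, map_sum]
    exact Finset.sum_congr rfl fun y _ => by rw [conj_stdAddChar, mul_comm b y]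
  rw [Finset.sum_congr rfl hconst, Finset.sum_const, card_toFinset, nsmul_eq_mul] at hsum
  have ht : (Nat.card Γ : ℂ) ≠ 0 := by exact_mod_cast (card_pos_subgroup Γ).ne'
  change f y = _
  rw [hconst y hy, Complex.ofReal_div, ← hsum, Complex.ofReal_natCast]
  field_simp

/-- A sixth-power bound for the mean square of the Fourier transform of `Γ` on an invariant set. -/
theorem meanSquare_pow_six_le {R : Finset (ZMod p)} (hR : IsInvariant Γ R) :
    ((∑ b ∈ R, ‖charSum (toFinset Γ) b‖ ^ 2) / Nat.card Γ) ^ 6 ≤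
      (p : ℝ) ^ 2 * thirdEnergy (toFinset Γ) * thirdEnergy R := by
  set G := toFinset Γ with hG
  set t : ℝ := (Nat.card Γ : ℝ) with ht
  have htpos : 0 < t := by rw [ht]; exact_mod_cast card_pos_subgroup Γ
  set lam : ℝ := (∑ b ∈ R, ‖charSum G b‖ ^ 2) / t with hlam
  have hlam0 : 0 ≤ lam := by positivity
  have hlamt : ∑ b ∈ R, ‖charSum G b‖ ^ 2 = t * lam := by rw [hlam]; field_simp
  -- P is the matrix M M* M. Its row sums are λ times those of M, and its squared Hilbert–Schmidt
  -- norm is tr (M*M)³.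
  set P : ZMod p × ZMod p → ℂ := fun w => ∑ y ∈ G, ∑ b ∈ R,
    ZMod.stdAddChar (w.1 * y - b * y + b * w.2) with hP
  have hrow : ∀ a, ∑ x ∈ G, P (a, x) = lam * charSum G a := by
    intro a
    simp only [hP]
    rw [Finset.sum_comm, charSum, Finset.mul_sum]
    refine Finset.sum_congr rfl fun y hy => ?_
    rw [Finset.sum_comm, hlam, ht, ← sum_stdAddChar_mul_charSum hR hy, Finset.sum_mul]
    refine Finset.sum_congr rfl fun b _ => ?_
    rw [charSum, Finset.mul_sum, Finset.sum_mul]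
    refine Finset.sum_congr rfl fun x _ => ?_
    rw [← AddChar.map_add_eq_mul, ← AddChar.map_add_eq_mul]
    congr 1; ring
  have htot : ∑ w ∈ R ×ˢ G, conj (charSum G w.1) * P w = ((t * lam ^ 2 : ℝ) : ℂ) := by
    rw [Finset.sum_product]
    simp only [← Finset.mul_sum, hrow]
    have : ((t * lam ^ 2 : ℝ) : ℂ) = lam * ((∑ b ∈ R, ‖charSum G b‖ ^ 2 : ℝ) : ℂ) := by
      rw [hlamt]; push_cast; ring
    rw [this, Complex.ofReal_sum, Finset.mul_sum]
    refine Finset.sum_congr rfl fun a _ => ?_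
    rw [Complex.ofReal_pow, ← Complex.conj_mul']; ring
  have hCS : (t * lam ^ 2) ^ 2 ≤ (t ^ 2 * lam) * ∑ w ∈ R ×ˢ G, ‖P w‖ ^ 2 := by
    have h1 : t * lam ^ 2 ≤ ∑ w ∈ R ×ˢ G, ‖charSum G w.1‖ * ‖P w‖ := by
      have h2 : t * lam ^ 2 = ‖((t * lam ^ 2 : ℝ) : ℂ)‖ := by
        rw [Complex.norm_real, Real.norm_of_nonneg (by positivity)]
      rw [h2, ← htot]
      refine (norm_sum_le _ _).trans (le_of_eq ?_)
      simp
    have h3 : ∑ w ∈ R ×ˢ G, ‖charSum G w.1‖ ^ 2 = t ^ 2 * lam := by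
      rw [Finset.sum_product]
      simp only [Finset.sum_const, nsmul_eq_mul, ← Finset.mul_sum]
      rw [hlamt, hG, card_toFinset]; ring
    rw [← h3]
    exact (pow_le_pow_left₀ (by positivity) h1 2).trans (Finset.sum_mul_sq_le_sq_mul_sq _ _ _)
  have hsix : ((∑ w ∈ R ×ˢ G, ‖P w‖ ^ 2 : ℝ) : ℂ) = sixfoldSum G R := by
    push_cast
    simp only [← Complex.mul_conj', hP, map_sum, Finset.sum_mul_sum, conj_stdAddChar,
      ← AddChar.map_add_eq_mul, sixfoldSum, Finset.sum_product]
    rw [Finset.sum_comm]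
    refine Finset.sum_congr rfl fun x _ => ?_
    rw [Finset.sum_comm]
    refine Finset.sum_congr rfl fun y _ => ?_
    rw [Finset.sum_comm]
    refine Finset.sum_congr rfl fun y' _ => Finset.sum_congr rfl fun a _ =>
      Finset.sum_congr rfl fun b _ => Finset.sum_congr rfl fun b' _ => ?_
    congr 1; ring
  have hS0 : 0 ≤ ∑ w ∈ R ×ˢ G, ‖P w‖ ^ 2 := by positivity
  have hcube : lam ^ 3 ≤ ∑ w ∈ R ×ˢ G, ‖P w‖ ^ 2 := by
    rcases hlam0.eq_or_lt with h0 | hpos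
    · rw [← h0]; simpa using hS0
    · have h4 : (t ^ 2 * lam) * lam ^ 3 ≤ (t ^ 2 * lam) * ∑ w ∈ R ×ˢ G, ‖P w‖ ^ 2 := by
        calc _ = (t * lam ^ 2) ^ 2 := by ring
          _ ≤ _ := hCS
      exact le_of_mul_le_mul_left h4 (by positivity)
  calc lam ^ 6 = (lam ^ 3) ^ 2 := by ring
    _ ≤ (∑ w ∈ R ×ˢ G, ‖P w‖ ^ 2) ^ 2 := by gcongr
    _ = ‖sixfoldSum G R‖ ^ 2 := by
        rw [← hsix, Complex.norm_real, Real.norm_of_nonneg hS0]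
    _ ≤ _ := norm_sixfoldSum_sq_le G R

end Fourier

/-! ### Pointwise bound, large spectrum and the moment of order 32/5. -/

section Bounds

variable {p : ℕ} [Fact p.Prime] {Γ : Subgroup (ZMod p)ˣ}

lemma norm_hat (A : Finset (ZMod p)) (ξ : ZMod p) : ‖hat A ξ‖ = ‖charSum A ξ‖ := by
  have : hat A ξ = (starRingEnd ℂ) (charSum A ξ) := by
    rw [hat, ZMod.dft_apply, charSum, map_sum]
    simp only [conj_stdAddChar, smul_eq_mul, mul_ite, mul_one, mul_zero, Finset.sum_ite_mem,
      Finset.univ_inter]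
  rw [this, RCLike.norm_conj]

lemma one_le_logb_card (ht : 2 ≤ Nat.card Γ) : 1 ≤ Real.logb 2 (Nat.card Γ) := by
  rw [Real.le_logb_iff_rpow_le (by norm_num) (by positivity), Real.rpow_one]
  exact_mod_cast ht

/-- On the single coset R = Γξ the mean square is |Γ̂(ξ)|² itself. -/
theorem norm_charSum_pow_six_le (ht : 2 ≤ Nat.card Γ) (hp : Nat.card Γ ^ 3 ≤ p ^ 2) {ξ : ZMod p}
    (hξ : ξ ≠ 0) : ‖charSum (toFinset Γ) ξ‖ ^ 6 ≤
      2 ^ 19 * p * (Nat.card Γ : ℝ) ^ 3 * Real.logb 2 (Nat.card Γ) := by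
  set t := Nat.card Γ with htdef
  have htpos : (0 : ℝ) < t := by rw [htdef]; exact_mod_cast card_pos_subgroup Γ
  have hL := one_le_logb_card ht
  set R := (toFinset Γ).image (· * ξ) with hRdef
  have hR : IsInvariant Γ R := by
    refine ⟨fun x hx => ?_, fun γ hγ x hx => ?_⟩
    · obtain ⟨δ, hδ, rfl⟩ := Finset.mem_image.1 hx
      exact mul_ne_zero (ne_zero_of_mem hδ) hξ
    · obtain ⟨δ, hδ, rfl⟩ := Finset.mem_image.1 hx
      exact Finset.mem_image.2 ⟨γ * δ, mul_mem_toFinset hγ hδ, mul_assoc _ _ _⟩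
  have hRcard : R.card = t := by
    rw [hRdef, Finset.card_image_of_injective _ (mul_left_injective₀ hξ), card_toFinset]
  have hR1 : cosets Γ R = 1 := by
    have := hR.card_eq
    rw [hRcard] at this
    exact Nat.eq_of_mul_eq_mul_left (card_pos_subgroup Γ) (by rw [← this, mul_one])
  have h1 := meanSquare_pow_six_le hR
  have h2 : ∑ b ∈ R, ‖charSum (toFinset Γ) b‖ ^ 2 = t * ‖charSum (toFinset Γ) ξ‖ ^ 2 := by
    rw [← hRcard, ← nsmul_eq_mul, ← Finset.sum_const]
    refine Finset.sum_congr rfl fun b hb => ?_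
    obtain ⟨δ, hδ, rfl⟩ := Finset.mem_image.1 hb
    simp only [charSum_mul hδ]
  rw [h2, mul_div_cancel_left₀ _ htpos.ne'] at h1
  have h3 : ∀ S : Finset (ZMod p), IsInvariant Γ S → cosets Γ S = 1 →
      (thirdEnergy S : ℝ) ≤ 2 ^ 19 * (t : ℝ) ^ 3 * Real.logb 2 t := by
    intro S hS hS1
    have := thirdEnergy_le hS ht (by omega) (by rw [hS1, one_mul]; exact hp)
    rw [hS1] at this
    simpa using this
  have h4 := h3 _ (isInvariant_toFinset Γ) (cosets_toFinset Γ)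
  have h5 := h3 _ hR hR1
  refine le_of_sq_le_sq ?_ (by positivity)
  calc (‖charSum (toFinset Γ) ξ‖ ^ 6) ^ 2 = (‖charSum (toFinset Γ) ξ‖ ^ 2) ^ 6 := by ring
    _ ≤ (p : ℝ) ^ 2 * thirdEnergy (toFinset Γ) * thirdEnergy R := h1
    _ ≤ (p : ℝ) ^ 2 * (2 ^ 19 * (t : ℝ) ^ 3 * Real.logb 2 t) *
        (2 ^ 19 * (t : ℝ) ^ 3 * Real.logb 2 t) := by gcongr
    _ = _ := by ring

/-- The nonzero frequencies at which the Fourier transform of `Γ` is at least `τ`. -/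
def largeSpectrum (Γ : Subgroup (ZMod p)ˣ) (τ : ℝ) : Finset (ZMod p) :=
  (Finset.univ.erase 0).filter fun ξ => τ ≤ ‖charSum (toFinset Γ) ξ‖

lemma isInvariant_largeSpectrum (Γ : Subgroup (ZMod p)ˣ) (τ : ℝ) :
    IsInvariant Γ (largeSpectrum Γ τ) := by
  refine ⟨fun x hx => (Finset.mem_erase.1 (Finset.mem_filter.1 hx).1).1, fun γ hγ x hx => ?_⟩
  obtain ⟨h1, h2⟩ := Finset.mem_filter.1 hx
  refine Finset.mem_filter.2 ⟨Finset.mem_erase.2 ⟨mul_ne_zero (ne_zero_of_mem hγ)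
    (Finset.mem_erase.1 h1).1, Finset.mem_univ _⟩, ?_⟩
  rwa [charSum_mul hγ]

/-- On exactly K cosets of the large spectrum λ ≥ Kτ², so the sixth-power inequality has K⁶ on the
left against K⁵ from the third energy. -/
theorem mul_pow_twelve_le_of_le_cosets (ht : 2 ≤ Nat.card Γ) {K : ℕ} (hK : 1 ≤ K)
    (hKt : K ≤ Nat.card Γ) (hp : K * Nat.card Γ ^ 3 ≤ p ^ 2) {τ : ℝ} (hτ : 0 ≤ τ)
    (hcos : K ≤ cosets Γ (largeSpectrum Γ τ)) :
    K * τ ^ 12 ≤ 2 ^ 38 * (p : ℝ) ^ 2 * (Nat.card Γ : ℝ) ^ 6 * Real.logb 2 (Nat.card Γ) ^ 2 := by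
  obtain ⟨R, hRsub, hR, hRK⟩ := (isInvariant_largeSpectrum Γ τ).exists_subset hcos
  set t := Nat.card Γ with htdef
  have htpos : (0 : ℝ) < t := by rw [htdef]; exact_mod_cast card_pos_subgroup Γ
  have hL := one_le_logb_card ht
  have hKpos : (0 : ℝ) < K := by exact_mod_cast hK
  have h1 := meanSquare_pow_six_le hR
  have h2 : K * τ ^ 2 ≤ (∑ b ∈ R, ‖charSum (toFinset Γ) b‖ ^ 2) / t := by
    rw [le_div_iff₀ htpos]
    have h3 : R.card • τ ^ 2 ≤ ∑ b ∈ R, ‖charSum (toFinset Γ) b‖ ^ 2 := by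
      refine Finset.card_nsmul_le_sum _ _ _ fun b hb => ?_
      have := (Finset.mem_filter.1 (hRsub hb)).2
      gcongr
    rw [hR.card_eq, hRK, nsmul_eq_mul] at h3
    push_cast at h3
    linarith
  have h4 := thirdEnergy_le (isInvariant_toFinset Γ) ht (by rw [cosets_toFinset]; omega)
    (by rw [cosets_toFinset]; exact le_trans (Nat.mul_le_mul_right _ hK) hp)
  have h5 := thirdEnergy_le hR ht (by rw [hRK]; exact hKt) (by rw [hRK]; exact hp)
  rw [cosets_toFinset] at h4
  rw [hRK] at h5
  have h6 : (K : ℝ) ^ 5 * (K * τ ^ 12) ≤ (K : ℝ) ^ 5 *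
      (2 ^ 38 * (p : ℝ) ^ 2 * (t : ℝ) ^ 6 * Real.logb 2 t ^ 2) := by
    calc (K : ℝ) ^ 5 * (K * τ ^ 12) = (K * τ ^ 2) ^ 6 := by ring
      _ ≤ ((∑ b ∈ R, ‖charSum (toFinset Γ) b‖ ^ 2) / t) ^ 6 := by gcongr
      _ ≤ (p : ℝ) ^ 2 * thirdEnergy (toFinset Γ) * thirdEnergy R := h1
      _ ≤ (p : ℝ) ^ 2 * (2 ^ 19 * ((1 : ℕ) : ℝ) ^ 5 * (t : ℝ) ^ 3 * Real.logb 2 t) *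
          (2 ^ 19 * (K : ℝ) ^ 5 * (t : ℝ) ^ 3 * Real.logb 2 t) := by gcongr
      _ = _ := by push_cast; ring
  exact le_of_mul_le_mul_left h6 (by positivity)

lemma energy_eq_sum_diffCount_sq (A : Finset (ZMod p)) : energy A = ∑ z, diffCount A z ^ 2 := by
  rw [energy, Finset.addEnergy_eq_card_filter, Finset.card_eq_sum_card_fiberwise
    (f := fun x => x.2.1 - x.1.1) (t := Finset.univ)
    (fun _ _ => Finset.mem_coe.2 (Finset.mem_univ _))]
  refine Finset.sum_congr rfl fun z _ => ?_
  have : diffCount A z ^ 2 =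
      ((A.filter fun y => y + z ∈ A) ×ˢ (A.filter fun y => y + z ∈ A)).card := by
    rw [Finset.card_product, diffCount]; ring
  rw [this]
  refine Finset.card_nbij' (fun x => (x.1.1, x.2.2))
    (fun x => ((x.1, x.2 + z), (x.1 + z, x.2))) ?_ ?_ ?_ ?_
  · rintro ⟨⟨x, y⟩, x', y'⟩ h
    simp only [Finset.coe_filter, Finset.mem_filter, Finset.mem_product, Set.mem_ofPred_eq,
      Finset.coe_product, Set.mem_prod] at h ⊢
    obtain ⟨⟨⟨⟨h1, h2⟩, h3, h4⟩, h5⟩, h6⟩ := h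
    have e1 : x + z = x' := by linear_combination -h6
    have e2 : y' + z = y := by linear_combination -h6 - h5
    rw [e1, e2]
    exact ⟨⟨h1, h3⟩, h4, h2⟩
  · rintro ⟨x, y⟩ h
    simp only [Finset.coe_filter, Finset.mem_filter, Finset.mem_product, Set.mem_ofPred_eq,
      Finset.coe_product, Set.mem_prod] at h ⊢
    obtain ⟨⟨h1, h2⟩, h3, h4⟩ := h
    refine ⟨⟨⟨⟨h1, h4⟩, h2, h3⟩, ?_⟩, ?_⟩ <;> ring
  · rintro ⟨⟨x, y⟩, x', y'⟩ h
    simp only [Finset.coe_filter, Finset.mem_filter, Finset.mem_product, Set.mem_ofPred_eq] at h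
    obtain ⟨⟨-, h5⟩, h6⟩ := h
    simp only [Prod.mk.injEq, true_and, and_true]
    refine ⟨?_, ?_⟩
    · linear_combination -h6 - h5
    · linear_combination -h6
  · rintro ⟨x, y⟩ _; rfl

lemma sum_diffCount (Γ : Subgroup (ZMod p)ˣ) :
    ∑ z, diffCount (toFinset Γ) z = Nat.card Γ ^ 2 := by
  have h : Nat.card Γ * ∑ z, diffCount (toFinset Γ) z = Nat.card Γ * Nat.card Γ ^ 2 := by
    rw [Finset.mul_sum]
    simp only [card_mul_diffCount (isInvariant_toFinset Γ)]
    rw [Finset.sum_comm]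
    simp only [sum_shiftCount, Finset.sum_const, card_toFinset, smul_eq_mul]
    ring
  exact Nat.eq_of_mul_eq_mul_left (card_pos_subgroup Γ) h

/-- Cauchy–Schwarz interpolates the second moment of `diffCount` between the first, t², and the
third. -/
lemma energy_sq_le (ht : 2 ≤ Nat.card Γ) (hp : Nat.card Γ ^ 3 ≤ p ^ 2) :
    (energy (toFinset Γ) : ℝ) ^ 2 ≤
      2 ^ 19 * (Nat.card Γ : ℝ) ^ 5 * Real.logb 2 (Nat.card Γ) := by
  have h1 : (energy (toFinset Γ) : ℝ) ^ 2 ≤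
      (∑ z, (diffCount (toFinset Γ) z : ℝ)) * ∑ z, (diffCount (toFinset Γ) z : ℝ) ^ 3 := by
    rw [energy_eq_sum_diffCount_sq]
    push_cast
    exact Finset.sum_sq_le_sum_mul_sum_of_sq_le_mul _ (fun _ _ => by positivity)
      (fun _ _ => by positivity) (fun _ _ => by ring_nf; rfl)
  have h2 : ∑ z, (diffCount (toFinset Γ) z : ℝ) = (Nat.card Γ : ℝ) ^ 2 := by
    exact_mod_cast sum_diffCount Γ
  have h3 : ∑ z, (diffCount (toFinset Γ) z : ℝ) ^ 3 = thirdEnergy (toFinset Γ) := by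
    rw [thirdEnergy]; push_cast; rfl
  have h4 := thirdEnergy_le (isInvariant_toFinset Γ) ht (by rw [cosets_toFinset]; omega)
    (by rw [cosets_toFinset, one_mul]; exact hp)
  rw [cosets_toFinset] at h4
  rw [h2, h3] at h1
  calc _ ≤ _ := h1
    _ ≤ (Nat.card Γ : ℝ) ^ 2 * (2 ^ 19 * ((1 : ℕ) : ℝ) ^ 5 * (Nat.card Γ : ℝ) ^ 3 *
        Real.logb 2 (Nat.card Γ)) := by gcongr
    _ = _ := by push_cast; ring

lemma card_sq_le_energy (Γ : Subgroup (ZMod p)ˣ) :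
    Nat.card Γ ^ 2 ≤ energy (toFinset Γ) := by
  rw [← card_toFinset]
  exact Finset.le_addEnergy_self

lemma card_lt_prime (Γ : Subgroup (ZMod p)ˣ) : Nat.card Γ < p := by
  rw [← card_toFinset]
  calc (toFinset Γ).card < (Finset.univ : Finset (ZMod p)).card :=
        Finset.card_lt_card (Finset.ssubset_univ_iff.2 fun h =>
          ne_zero_of_mem (h ▸ Finset.mem_univ (0 : ZMod p)) rfl)
    _ = p := by rw [Finset.card_univ, ZMod.card]

lemma card_pow_three_le (h : (Nat.card Γ : ℝ) ≤ (p : ℝ) ^ (2 / 3 : ℝ)) :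
    Nat.card Γ ^ 3 ≤ p ^ 2 := by
  have h1 : (Nat.card Γ : ℝ) ^ 3 ≤ ((p : ℝ) ^ (2 / 3 : ℝ)) ^ 3 := by gcongr
  rw [← Real.rpow_natCast ((p : ℝ) ^ (2 / 3 : ℝ)), ← Real.rpow_mul (by positivity)] at h1
  norm_num at h1
  exact_mod_cast h1

theorem maxCoeff_le (ht : 2 ≤ Nat.card Γ) (hp : (Nat.card Γ : ℝ) ≤ (p : ℝ) ^ (2 / 3 : ℝ)) :
    maxCoeff (toFinset Γ) ≤ 2 ^ 4 * ((Nat.card Γ : ℝ) ^ (1 / 2 : ℝ) * (p : ℝ) ^ (1 / 6 : ℝ)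
      * (Real.logb 2 (Nat.card Γ : ℝ)) ^ (1 / 6 : ℝ)) := by
  have hL := one_le_logb_card ht
  refine Real.iSup_le (fun ξ => ?_) (by positivity)
  have h1 := norm_charSum_pow_six_le ht (card_pow_three_le hp) ξ.2
  have h2 : ∀ x : ℝ, 0 ≤ x → (x ^ (1 / 6 : ℝ)) ^ 6 = x := by
    intro x hx
    rw [← Real.rpow_natCast, ← Real.rpow_mul hx]; norm_num
  have h3 : ∀ x : ℝ, 0 ≤ x → (x ^ (1 / 2 : ℝ)) ^ 6 = x ^ 3 := by
    intro x hx
    rw [← Real.rpow_natCast, ← Real.rpow_mul hx, ← Real.rpow_natCast]; norm_num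
  -- The constant suffices because 2¹⁹ ≤ (2⁴)⁶.
  refine le_of_pow_le_pow_left₀ (n := 6) (by norm_num) (by positivity) (h1.trans ?_)
  rw [mul_pow, mul_pow, mul_pow, h2 _ (by positivity), h2 _ (by positivity), h3 _ (by positivity)]
  have : (0 : ℝ) ≤ (Nat.card Γ : ℝ) ^ 3 * p * Real.logb 2 (Nat.card Γ) := by positivity
  nlinarith

/-- The exponent 1/100 is small enough for surplus logarithms to fit into the power of t left over
in the moment bound. -/
lemma logb_two_le {t : ℝ} (ht : 0 < t) : Real.logb 2 t ≤ 200 * t ^ (1 / 100 : ℝ) := by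
  have h1 := Real.log_le_rpow_div ht.le (show (0 : ℝ) < 1 / 100 by norm_num)
  have h2 := Real.log_two_gt_d9
  have h3 : 0 < t ^ (1 / 100 : ℝ) := by positivity
  rw [Real.logb, div_le_iff₀ (by linarith)]
  nlinarith

theorem sum_norm_charSum_le (ht : 2 ≤ Nat.card Γ) (hp : Nat.card Γ ^ 3 ≤ p ^ 2) {α : ℝ}
    (hα : 0 ≤ α) (hcond : (p : ℝ) ^ 10 ≤ Real.exp α * ((Nat.card Γ : ℝ) ^ 22 *
      (energy (toFinset Γ) : ℝ) ^ 2 * (Real.logb 2 (Nat.card Γ : ℝ)) ^ 9)) :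
    ∑ ξ ∈ (Finset.univ : Finset (ZMod p)).erase 0,
        ‖charSum (toFinset Γ) ξ‖ ^ (32 / 5 : ℝ) ≤
      (2 * Real.exp (200 * (α + Real.log 2 + Real.log 200))) * ((Nat.card Γ : ℝ) ^ (16 / 5 : ℝ)
        * (energy (toFinset Γ) : ℝ) ^ (2 / 5 : ℝ) * (p : ℝ) ^ (6 / 5 : ℝ)
        * (Real.logb 2 (Nat.card Γ : ℝ)) ^ (9 / 5 : ℝ)) := by
  have hE1 := energy_sq_le ht hp
  have hE2 : (Nat.card Γ : ℝ) ^ 2 ≤ energy (toFinset Γ) := by exact_mod_cast card_sq_le_energy Γ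
  have hlt : (Nat.card Γ : ℝ) ≤ p := by exact_mod_cast (card_lt_prime Γ).le
  have hsix := fun ξ : ZMod p => fun hξ : ξ ≠ 0 => norm_charSum_pow_six_le ht hp hξ
  have hlev := fun K : ℕ => fun hK : 1 ≤ K => fun hKt hp τ hτ hcos =>
    mul_pow_twelve_le_of_le_cosets (Γ := Γ) (K := K) ht hK hKt hp (τ := τ) hτ hcos
  have hfour := sum_norm_charSum_pow_four (toFinset Γ)
  have hL1 := one_le_logb_card ht
  have hLup := logb_two_le (t := (Nat.card Γ : ℝ)) (by positivity)
  have ht1 : (1 : ℝ) ≤ (Nat.card Γ : ℝ) := by exact_mod_cast card_pos_subgroup Γ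
  have hspec := fun τ => (isInvariant_largeSpectrum Γ τ).card_eq
  set f : ZMod p → ℝ := fun ξ => ‖charSum (toFinset Γ) ξ‖ with hf
  -- In logarithmic variables for t, p, E and L the inequalities to be balanced become linear.
  obtain ⟨x, hx⟩ : ∃ x, Real.exp x = (Nat.card Γ : ℝ) := ⟨_, Real.exp_log (by linarith)⟩
  obtain ⟨q, hq⟩ : ∃ q, Real.exp q = (p : ℝ) := ⟨_, Real.exp_log (by linarith)⟩
  obtain ⟨y, hy⟩ : ∃ y, Real.exp y = (energy (toFinset Γ) : ℝ) :=
    ⟨_, Real.exp_log (by nlinarith)⟩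
  obtain ⟨l, hl⟩ : ∃ l, Real.exp l = Real.logb 2 (Nat.card Γ : ℝ) :=
    ⟨_, Real.exp_log (by linarith)⟩
  set c := Real.log 2 with hc
  have hc0 : 0 ≤ c := Real.log_nonneg (by norm_num)
  have hec : Real.exp c = 2 := Real.exp_log (by norm_num)
  set d := Real.log 200 with hd
  have hd0 : 0 ≤ d := Real.log_nonneg (by norm_num)
  have hed : Real.exp d = 200 := Real.exp_log (by norm_num)
  have e19 : (2 : ℝ) ^ 19 = Real.exp (19 * c) := by
    rw [← hec, ← Real.exp_nat_mul]; norm_num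
  have e38 : (2 : ℝ) ^ 38 = Real.exp (38 * c) := by
    rw [← hec, ← Real.exp_nat_mul]; norm_num
  have hc1 : 0 < c := Real.log_pos (by norm_num)
  have hsmallcase : (Nat.card Γ : ℝ) ^ 3 ≤ (p : ℝ) ^ 2 := by exact_mod_cast hp
  rw [← hl, ← hx, ← hq, ← hy] at hcond
  rw [← hl, ← hx, ← hy, e19] at hE1
  rw [← hx, ← hy] at hE2
  rw [← hx, ← hq] at hlt hsmallcase
  rw [← hl] at hL1
  rw [← hl, ← hx, ← hed] at hLup
  rw [← hq, ← hy] at hfour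
  simp only [← hl] at hsix hlev
  simp only [← hx, ← hq, e19] at hsix
  rw [← hl, ← hx, ← hq, ← hy]
  simp only [← Real.exp_mul, ← Real.exp_nat_mul, ← Real.exp_add, Real.exp_le_exp,
    Nat.cast_ofNat, Real.one_le_exp_iff] at hcond hE1 hE2 hlt hsmallcase hL1 hLup hfour hsix ⊢
  -- The value e^k = p E³ / t¹⁰ is the K for which (p² t⁶ L² / K)^{1/5} · pE has the powers of t, p
  -- and E of the target. The slack β absorbs the constants A, 2 and 200.
  set k := q + 3 * y - 10 * x with hk
  set β := 40 * (α + c + d) with hβ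
  have hx0 : 0 ≤ x := by rw [← Real.one_le_exp_iff, hx]; exact ht1
  have hk1 : k - β ≤ x := by linarith
  have hk2 : k - β + 3 * x ≤ 2 * q := by linarith
  -- Subtracting c = log 2 pays for the ceiling: either K = 1, or rounding up at most doubles.
  set K := ⌈Real.exp (k - β - c)⌉₊ with hK
  have hKpos : 1 ≤ K := Nat.ceil_pos.2 (Real.exp_pos _)
  have hKt : K ≤ Nat.card Γ := by
    rw [hK, Nat.ceil_le, ← hx, Real.exp_le_exp]; linarith
  have hKp : K * Nat.card Γ ^ 3 ≤ p ^ 2 := by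
    rcases le_or_gt (Real.exp (k - β - c)) 1 with h | h
    · have : K ≤ 1 := Nat.ceil_le.2 (by exact_mod_cast h)
      calc K * Nat.card Γ ^ 3 ≤ 1 * Nat.card Γ ^ 3 := Nat.mul_le_mul_right _ this
        _ ≤ p ^ 2 := by rw [one_mul]; exact hp
    · have h1 : (K : ℝ) ≤ Real.exp (k - β) := by
        have h2 : (K : ℝ) < Real.exp (k - β - c) + 1 := Nat.ceil_lt_add_one (Real.exp_pos _).le
        have h3 : Real.exp (k - β) = Real.exp (k - β - c) * 2 := by
          rw [← hec, ← Real.exp_add]; congr 1; ring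
        linarith
      have h4 : (K : ℝ) * (Nat.card Γ : ℝ) ^ 3 ≤ (p : ℝ) ^ 2 := by
        rw [← hx, ← hq]
        calc (K : ℝ) * Real.exp x ^ 3 ≤ Real.exp (k - β) * Real.exp x ^ 3 := by gcongr
          _ ≤ Real.exp q ^ 2 := by
            rw [← Real.exp_nat_mul, ← Real.exp_nat_mul, ← Real.exp_add, Real.exp_le_exp]
            push_cast; linarith
      exact_mod_cast h4
  -- The threshold τ = e^s makes K τ¹² at least 2³⁹ p² t⁶ L², beyond the permitted 2³⁸, so the large
  -- spectrum has fewer than K cosets.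
  set s := (40 * c + 2 * q + 6 * x + 2 * l - k + β) / 12 with hs
  have hcos : (cosets Γ (largeSpectrum Γ (Real.exp s)) : ℝ) < Real.exp (k - β - c) := by
    rw [← Nat.lt_ceil]
    by_contra! hle
    have h1 := hlev K hKpos hKt hKp (Real.exp s) (Real.exp_pos _).le hle
    rw [← hx, ← hq, e38] at h1
    have h2 : Real.exp (k - β - c) * Real.exp s ^ 12 ≤ K * Real.exp s ^ 12 := by
      gcongr; exact Nat.le_ceil _
    have h3 := h2.trans h1
    simp only [← Real.exp_nat_mul, ← Real.exp_add, Real.exp_le_exp, Nat.cast_ofNat] at h3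
    linarith
  have hf0 : ∀ ξ, 0 ≤ f ξ := fun ξ => norm_nonneg _
  have hlarge : ∑ ξ ∈ largeSpectrum Γ (Real.exp s), f ξ ^ (32 / 5 : ℝ) ≤
      Real.exp (x + (k - β - c) + (19 * c + q + 3 * x + l) * (16 / 15)) := by
    have h1 : ∀ ξ ∈ largeSpectrum Γ (Real.exp s), f ξ ^ (32 / 5 : ℝ) ≤
        Real.exp ((19 * c + q + 3 * x + l) * (16 / 15)) := by
      intro ξ hξ
      have h2 := hsix ξ ((isInvariant_largeSpectrum Γ _).ne_zero ξ hξ)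
      have h3 : f ξ ^ (32 / 5 : ℝ) = (f ξ ^ 6) ^ (16 / 15 : ℝ) := by
        rw [← Real.rpow_natCast, ← Real.rpow_mul (hf0 ξ)]; norm_num
      rw [h3, Real.exp_mul]
      exact Real.rpow_le_rpow (pow_nonneg (hf0 ξ) 6) h2 (by norm_num)
    refine (Finset.sum_le_card_nsmul _ _ _ h1).trans ?_
    rw [hspec, nsmul_eq_mul, Nat.cast_mul, ← hx, Real.exp_add, Real.exp_add x]
    gcongr
  have hsmall : ∑ ξ ∈ (Finset.univ.erase 0).filter (fun ξ => ¬ Real.exp s ≤ f ξ),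
      f ξ ^ (32 / 5 : ℝ) ≤ Real.exp (s * (12 / 5) + (q + y)) := by
    calc _ ≤ ∑ ξ ∈ (Finset.univ.erase 0).filter (fun ξ => ¬ Real.exp s ≤ f ξ),
          Real.exp (s * (12 / 5)) * f ξ ^ 4 := by
          refine Finset.sum_le_sum fun ξ hξ => ?_
          have h1 : f ξ ≤ Real.exp s := (not_le.1 (Finset.mem_filter.1 hξ).2).le
          have h2 : f ξ ^ (32 / 5 : ℝ) = f ξ ^ (12 / 5 : ℝ) * f ξ ^ 4 := by
            rw [← Real.rpow_natCast, ← Real.rpow_add_of_nonneg (hf0 ξ) (by norm_num) (by norm_num)]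
            norm_num
          rw [h2, Real.exp_mul]
          have := hf0 ξ
          gcongr
      _ = Real.exp (s * (12 / 5)) *
          ∑ ξ ∈ (Finset.univ.erase 0).filter (fun ξ => ¬ Real.exp s ≤ f ξ), f ξ ^ 4 :=
          (Finset.mul_sum _ _ _).symm
      _ ≤ Real.exp (s * (12 / 5)) * ∑ ξ, f ξ ^ 4 := by
          gcongr
          exact Finset.subset_univ _
      _ = _ := by rw [hfour, ← Real.exp_add]
  rw [← Finset.sum_filter_add_sum_filter_not _ (fun ξ => Real.exp s ≤ f ξ), mul_assoc, two_mul,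
    ← Real.exp_add]
  refine add_le_add (hlarge.trans ?_) (hsmall.trans ?_)
  -- The hypothesis and E² ≪ t⁵ L give p E³ ≪ t^{10.2} L^{2.5}, whereas t^{135/13} L^{11/13} would
  -- do; the spare power of t swallows the logarithms.
  · rw [Real.exp_le_exp]; linarith
  · rw [Real.exp_le_exp]; linarith

end Bounds

end SubgroupSums

end

theorem theorem4p3 :
    (∃ C : ℝ, 0 < C ∧
      ∀ (p : ℕ) [Fact p.Prime] (Γ : Subgroup (ZMod p)ˣ),
        2 ≤ Nat.card Γ →
        (Nat.card Γ : ℝ) ≤ (p : ℝ) ^ (2 / 3 : ℝ) →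
        SubgroupSums.maxCoeff (SubgroupSums.toFinset Γ) ≤
          C * ((Nat.card Γ : ℝ) ^ (1 / 2 : ℝ) * (p : ℝ) ^ (1 / 6 : ℝ)
            * (Real.logb 2 (Nat.card Γ : ℝ)) ^ (1 / 6 : ℝ))) ∧
    (∀ A : ℝ, 0 < A → ∃ C : ℝ, 0 < C ∧
      ∀ (p : ℕ) [Fact p.Prime] (Γ : Subgroup (ZMod p)ˣ),
        (Nat.card Γ : ℝ) ≤ (p : ℝ) ^ (2 / 3 : ℝ) →
        (p : ℝ) ^ 10 ≤
          A * ((Nat.card Γ : ℝ) ^ 22 * (SubgroupSums.energy (SubgroupSums.toFinset Γ) : ℝ) ^ 2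
            * (Real.logb 2 (Nat.card Γ : ℝ)) ^ 9) →
        ∑ ξ ∈ (Finset.univ : Finset (ZMod p)).erase 0,
            ‖SubgroupSums.hat (SubgroupSums.toFinset Γ) ξ‖ ^ (32 / 5 : ℝ) ≤
          C * ((Nat.card Γ : ℝ) ^ (16 / 5 : ℝ)
            * (SubgroupSums.energy (SubgroupSums.toFinset Γ) : ℝ) ^ (2 / 5 : ℝ)
            * (p : ℝ) ^ (6 / 5 : ℝ)
            * (Real.logb 2 (Nat.card Γ : ℝ)) ^ (9 / 5 : ℝ))) := by
  refine ⟨⟨2 ^ 4, by norm_num, fun p _ Γ ht hp => SubgroupSums.maxCoeff_le ht hp⟩,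
    fun A hA => ⟨2 * Real.exp (200 * (max (Real.log A) 0 + Real.log 2 + Real.log 200)),
      by positivity, fun p _ Γ hp hcond => ?_⟩⟩
  have hp0 : 0 < (p : ℝ) := by exact_mod_cast (Fact.out : p.Prime).pos
  have ht : 2 ≤ Nat.card Γ := by
    by_contra! hlt
    have h1 : Nat.card Γ = 1 := by
      have := SubgroupSums.card_pos_subgroup Γ
      omega
    -- For the trivial subgroup the logarithm is 0, so the hypothesis would read p¹⁰ ≤ 0.
    rw [h1] at hcond
    norm_num at hcond
    exact absurd hcond (not_le.2 (by positivity))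
  simp only [SubgroupSums.norm_hat]
  have hL := SubgroupSums.one_le_logb_card ht
  refine SubgroupSums.sum_norm_charSum_le ht (SubgroupSums.card_pow_three_le hp) (le_max_right _ _)
    (hcond.trans ?_)
  gcongr
  calc A = Real.exp (Real.log A) := (Real.exp_log hA).symm
    _ ≤ _ := Real.exp_le_exp.2 (le_max_left _ _)
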